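/- Let $n\ge 1$ and $s\in\mathbb R$, and put $\mu_s(x)=(1+|x|^2)^{s/2}$ for $x\in\mathbb R^n$ and $\mathbb T^n=[-\tfrac12,\tfrac12)^n$. Let $H^s=H^s(\mathbb R^n)$ be the Hilbert space of all tempered distributions $f$ with $\|f\|_{H^s}=\|\mu_s\widehat f\|_{L^2}<\infty$, where $\widehat f(t)=\int f(x)e^{-2\pi i\langle x,t\rangle}\,dx$, and let $\ell^2_s$ be the Hilbert space of all sequences $c=(c_k)_{k\in\mathbb Z^n}$ with $\|c\|^2=\sum_k|c_k|^2\mu_s(k)^2<\infty$. For $f\in H^s$ put $$\mathcal T_sf(t)=\Big(\widehat f(t+k)\,\frac{\mu_s(t+k)}{\mu_s(k)}\Big)_{k\in\mathbb Z^n}\in\ell^2_s\qquad\text{for a.e. }t\in\mathbb T^n,$$ and let $T_kf=f(\cdot-k)$ for $k\in\mathbb Z^n$. A range function is a map $J$ from $\mathbb T^n$ to the closed subspaces of $\ell^2_s$; it is measurable if $t\mapsto\langle P_{J(t)}a,b\rangle$ is measurable for all $a,b\in\ell^2_s$, where $P_{J(t)}$ is the orthogonal projection onto $J(t)$. A range operator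 on $J$ is a map $R$ from $\mathbb T^n$ to the bounded operators from closed subspaces of $\ell^2_s$ to $\ell^2_s$ such that the domain of $R(t)$ is $J(t)$ for a.e. $t$; it is measurable if $t\mapsto\langle R(t)P_{\operatorname{dom}R(t)}a,b\rangle$ is measurable for all $a,b\in\ell^2_s$. Let $V_s\subseteq H^s$ be a closed subspace that is shift-invariant, i.e. $T_kV_s\subseteq V_s$ for all $k\in\mathbb Z^n$. A bounded linear operator $L:V_s\to H^s$ is shift-preserving if $LT_k=T_kL$ for all $k\in\mathbb Z^n$. There is a measurable range function $J_s$ with $$V_s=\{f\in H^s:\ \mathcal T_sf(t)\in J_s(t)\text{ for a.e. }t\in\mathbb T^n\},$$ and for every such $J_s$ the following hold. 1. For every shift-preserving operator $L:V_s\to H^s$ there is a measurable range operator $R_s$ on $J_s$, unique up to equality almost everywhere, such that for every $f\in V_s$ $$\mathcal T_s(Lf)(t)=R_s(t)\big(\mathcal T_sf(t)\big)\quad\text{for a.e. }t\in\mathbb T^n.\qquad(*)$$ 2. For every measurable range operator $R_s$ on $J_s$ with $\operatorname{ess\,sup}_{t\in\mathbb T^n}\|R_s(t)\|<\infty$ there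 is exactly one shift-preserving operator $L:V_s\to H^s$ that satisfies $(*)$ for every $f\in V_s$. 3. If a shift-preserving operator $L:V_s\to H^s$ and a measurable range operator $R_s$ on $J_s$ satisfy $(*)$ for every $f\in V_s$, then $L$ is an isometry if and only if $R_s(t)$ is an isometry for a.e. $t\in\mathbb T^n$. -/

import Mathlib

open MeasureTheory FourierTransform TemperedDistribution
open scoped SchwartzMap ENNReal

noncomputable section

namespace ShiftInv

/-- Euclidean space `ℝⁿ`. -/
abbrev Rn (n : ℕ) : Type := EuclideanSpace ℝ (Fin n)

/-- The lattice `ℤⁿ`. -/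
abbrev Zn (n : ℕ) : Type := Fin n → ℤ

/-- The inclusion `ℤⁿ ⊂ ℝⁿ`. -/
def latticePt {n : ℕ} (k : Zn n) : Rn n := WithLp.toLp 2 fun i => (k i : ℝ)

/-- The weight `μ_s(x) = (1 + |x|²)^{s/2}`. -/
def weight {n : ℕ} (s : ℝ) (x : Rn n) : ℝ := (1 + ‖x‖ ^ 2) ^ (s / 2)

/-- The half-open unit cube `𝕋ⁿ = [-1/2, 1/2)ⁿ`. -/
def cube (n : ℕ) : Set (Rn n) := {t | ∀ i, t i ∈ Set.Ico (-(1 / 2) : ℝ) (1 / 2)}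

/-- Lebesgue measure on `𝕋ⁿ`. -/
instance (n : ℕ) : MeasureSpace (cube n) := Measure.Subtype.measureSpace

/-! ### The weighted sequence space -/

/-- The measure on `ℤⁿ` that gives the point `k` the mass `μ_s(k)²`. -/
def weightedCount (n : ℕ) (s : ℝ) : Measure (Zn n) :=
  Measure.count.withDensity fun k => ENNReal.ofReal (weight s (latticePt k) ^ 2)

/-- The Hilbert space `ℓ²_s(ℤⁿ)` of the sequences `c` with `∑ₖ |c_k|² μ_s(k)² < ∞`. Every point of
`ℤⁿ` has positive mass, so that "almost everywhere" means "everywhere" here. -/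
abbrev SeqSpace (n : ℕ) (s : ℝ) : Type := Lp ℂ 2 (weightedCount n s)

/-! ### The Sobolev space -/

/-- The tempered distributions `f` on `ℝⁿ` with `μ_s f̂ ∈ L²`. -/
def sobolevSubmodule (n : ℕ) (s : ℝ) : Submodule ℂ 𝓢'(Rn n, ℂ) where
  carrier := {f | MemSobolev s 2 f}
  add_mem' hf hg := hf.add hg
  zero_mem' := memSobolev_fun_zero (Rn n) ℂ s 2
  smul_mem' c _ hf := hf.smul c

/-- The Sobolev space `H^s(ℝⁿ)`, as a type of its own, since its topology is the one of the norm
`‖μ_s f̂‖_{L²}` and not the one of the tempered distributions. -/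
def Sobolev (n : ℕ) (s : ℝ) : Type := sobolevSubmodule n s

namespace Sobolev

variable {n : ℕ} {s : ℝ}

instance : AddCommGroup (Sobolev n s) := inferInstanceAs (AddCommGroup (sobolevSubmodule n s))

instance : Module ℂ (Sobolev n s) := inferInstanceAs (Module ℂ (sobolevSubmodule n s))

/-- The tempered distribution that an element of `H^s` is. -/
def toDist : Sobolev n s →ₗ[ℂ] 𝓢'(Rn n, ℂ) := (sobolevSubmodule n s).subtype

theorem toDist_injective : Function.Injective (toDist : Sobolev n s → 𝓢'(Rn n, ℂ)) :=
  Subtype.val_injective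

theorem memSobolev (f : Sobolev n s) : MemSobolev s 2 (toDist f) := f.2

theorem exists_weightedFourier (f : Sobolev n s) : ∃ g : Lp ℂ 2 (volume : Measure (Rn n)),
    Lp.toTemperedDistributionCLM ℂ volume 2 g =
      smulLeftCLM ℂ (fun x => (weight s x : ℂ)) (𝓕 (toDist f)) := by
  obtain ⟨g, hg⟩ := memSobolev_iff_exists_smulLeftCLM_fourier.1 f.memSobolev
  exact ⟨g, hg.symm⟩

theorem toTemperedDistributionCLM_injective : Function.Injective
    (Lp.toTemperedDistributionCLM ℂ (volume : Measure (Rn n)) 2) :=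
  LinearMap.ker_eq_bot.1 Lp.ker_toTemperedDistributionCLM_eq_bot

/-- The function `μ_s f̂ ∈ L²(ℝⁿ)`, for `f ∈ H^s`. -/
def weightedFourier : Sobolev n s →ₗ[ℂ] Lp ℂ 2 (volume : Measure (Rn n)) where
  toFun f := (exists_weightedFourier f).choose
  map_add' f g := by
    apply toTemperedDistributionCLM_injective
    refine (exists_weightedFourier (f + g)).choose_spec.trans ?_
    rw [map_add (Lp.toTemperedDistributionCLM ℂ volume 2), (exists_weightedFourier f).choose_spec, (exists_weightedFourier g).choose_spec,
      map_add, FourierTransform.fourier_add, map_add]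
  map_smul' c f := by
    apply toTemperedDistributionCLM_injective
    refine (exists_weightedFourier (c • f)).choose_spec.trans ?_
    rw [RingHom.id_apply, map_smul (Lp.toTemperedDistributionCLM ℂ volume 2),
      (exists_weightedFourier f).choose_spec, map_smul,
      FourierTransform.fourier_smul, map_smul]

theorem toTemperedDistributionCLM_weightedFourier (f : Sobolev n s) :
    Lp.toTemperedDistributionCLM ℂ volume 2 (weightedFourier f) =
      smulLeftCLM ℂ (fun x => (weight s x : ℂ)) (𝓕 (toDist f)) :=
  (exists_weightedFourier f).choose_spec

theorem weight_hasTemperateGrowth (r : ℝ) :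
    (fun x : Rn n => (weight r x : ℂ)).HasTemperateGrowth := by
  unfold weight
  fun_prop

theorem weightedFourier_injective :
    Function.Injective (weightedFourier : Sobolev n s → Lp ℂ 2 (volume : Measure (Rn n))) := by
  intro f g h
  have h1 := toTemperedDistributionCLM_weightedFourier f
  rw [h, toTemperedDistributionCLM_weightedFourier g] at h1
  have h2 := congrArg (smulLeftCLM ℂ fun x => (weight (-s) x : ℂ)) h1
  have h3 : ((fun x : Rn n => (weight s x : ℂ)) * fun x => (weight (-s) x : ℂ)) = fun _ => 1 := by
    ext x
    have hx : (0 : ℝ) < 1 + ‖x‖ ^ 2 := by positivity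
    simp only [weight, Pi.mul_apply]
    rw [← Complex.ofReal_mul, ← Real.rpow_add hx]
    simp [neg_div]
  simp only [smulLeftCLM_smulLeftCLM_apply (weight_hasTemperateGrowth _)
    (weight_hasTemperateGrowth _), h3, smulLeftCLM_const, one_smul] at h2
  apply toDist_injective
  have h4 := congrArg (fun u : 𝓢'(Rn n, ℂ) => 𝓕⁻ u) h2
  simpa using h4.symm

/-- The norm `‖f‖_{H^s} = ‖μ_s f̂‖_{L²}`. -/
instance : NormedAddCommGroup (Sobolev n s) :=
  NormedAddCommGroup.induced (Sobolev n s) (Lp ℂ 2 (volume : Measure (Rn n))) weightedFourier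
    weightedFourier_injective

/-- The inner product `⟨f, g⟩_{H^s} = ∫ f̂ ĝ̄ μ_s²` (linear in the second slot, as in Mathlib). -/
instance : InnerProductSpace ℂ (Sobolev n s) :=
  InnerProductSpace.induced (weightedFourier : Sobolev n s →ₗ[ℂ] Lp ℂ 2 (volume : Measure (Rn n)))

end Sobolev

/-! ### Integer translations -/

/-- Translation `T_a f = f(· - a)` of tempered distributions, `⟨T_a f, φ⟩ = ⟨f, φ(· + a)⟩`. -/
def translateDist {n : ℕ} (a : Rn n) : 𝓢'(Rn n, ℂ) →L[ℂ] 𝓢'(Rn n, ℂ) :=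
  PointwiseConvergenceCLM.precomp ℂ (SchwartzMap.compSubConstCLM ℂ (-a))

theorem phase_hasTemperateGrowth {n : ℕ} (a : Rn n) :
    (fun x : Rn n => (Real.fourierChar (-inner ℝ x a) : ℂ)).HasTemperateGrowth := by
  have h1 : (fun y : ℝ => Complex.exp ((2 * Real.pi * Complex.I) * y)).HasTemperateGrowth := by
    have h0 : ∀ m : ℕ, iteratedDeriv m (fun y : ℝ => Complex.exp ((2 * Real.pi * Complex.I) * y)) =
        fun y : ℝ => (2 * Real.pi * Complex.I) ^ m *
          Complex.exp ((2 * Real.pi * Complex.I) * y) := by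
      intro m
      induction m with
      | zero => simp
      | succ m ih =>
        rw [iteratedDeriv_succ, ih]
        ext y
        have h := (((Complex.ofRealCLM.hasDerivAt (x := y)).const_mul
          (2 * Real.pi * Complex.I)).cexp.const_mul ((2 * Real.pi * Complex.I) ^ m)).deriv
        simp only [Complex.ofRealCLM_apply] at h
        rw [h]
        simp only [Complex.ofReal_one]
        ring
    refine ⟨(contDiff_const.mul Complex.ofRealCLM.contDiff).cexp,
      fun m => ⟨0, (2 * Real.pi) ^ m, fun y => ?_⟩⟩
    rw [norm_iteratedFDeriv_eq_norm_iteratedDeriv, h0]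
    simp [Complex.norm_exp, abs_of_pos Real.pi_pos]
  have h2 : (fun x : Rn n => -inner ℝ x a).HasTemperateGrowth := by fun_prop
  have h3 := h1.comp h2
  convert h3 using 2 with x
  simp [Real.fourierChar_apply, mul_comm, mul_assoc, mul_left_comm]

theorem translateDist_eq {n : ℕ} (a : Rn n) (f : 𝓢'(Rn n, ℂ)) :
    translateDist a f =
      fourierMultiplierCLM ℂ (fun x : Rn n => (Real.fourierChar (-inner ℝ x a) : ℂ)) f := by
  ext u
  rw [fourierMultiplierCLM_apply_apply]
  change f (SchwartzMap.compSubConstCLM ℂ (-a) u) = _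
  congr 1
  ext x
  have h1 : u (x + a) = 𝓕 (𝓕⁻ u) (x + a) := by simp
  rw [SchwartzMap.compSubConstCLM_apply, sub_neg_eq_add, h1, SchwartzMap.fourier_coe,
    SchwartzMap.fourier_coe, Real.fourier_eq, Real.fourier_eq]
  congr 1
  ext v
  rw [SchwartzMap.smulLeftCLM_apply_apply (phase_hasTemperateGrowth a), inner_add_right, neg_add,
    AddChar.map_add_eq_mul, mul_smul]
  rfl

/-- Translation `T_k f = f(· - k)` on `H^s`, for `k ∈ ℤⁿ`. -/
def Sobolev.shift {n : ℕ} {s : ℝ} (k : Zn n) (f : Sobolev n s) : Sobolev n s :=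
  ⟨translateDist (latticePt k) (Sobolev.toDist f), by
    rw [translateDist_eq]
    exact f.memSobolev.fourierMultiplierCLM_of_bounded (phase_hasTemperateGrowth _)
      ⟨1, fun x => (Circle.norm_coe _).le⟩⟩

/-- A subspace `V` of `H^s` is shift-invariant if `T_k f ∈ V` for all `f ∈ V` and `k ∈ ℤⁿ`. -/
def IsShiftInvariant {n : ℕ} {s : ℝ} (V : Submodule ℂ (Sobolev n s)) : Prop :=
  ∀ f ∈ V, ∀ k : Zn n, f.shift k ∈ V

/-- A bounded operator `L : V → H^s` on a shift-invariant space is shift-preserving if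
`L T_k = T_k L` for all `k ∈ ℤⁿ`. -/
def IsShiftPreserving {n : ℕ} {s : ℝ} {V : Submodule ℂ (Sobolev n s)} (hV : IsShiftInvariant V)
    (L : V →L[ℂ] Sobolev n s) : Prop :=
  ∀ (k : Zn n) (f : V), L ⟨(f : Sobolev n s).shift k, hV f f.2 k⟩ = (L f).shift k

/-! ### Fibers, range functions and range operators -/

open Classical in
/-- The fiberization `𝒯_s f(t) = (f̂(t + k) μ_s(t + k) / μ_s(k))_{k ∈ ℤⁿ} ∈ ℓ²_s`, for `f ∈ H^s` and
`t ∈ 𝕋ⁿ`; it is set to `0` on the null set where this sequence is not in `ℓ²_s`. -/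
def fiber {n : ℕ} {s : ℝ} (f : Sobolev n s) (t : cube n) : SeqSpace n s :=
  if h : MemLp (fun k : Zn n => Sobolev.weightedFourier f ((t : Rn n) + latticePt k) /
      (weight s (latticePt k) : ℂ)) 2 (weightedCount n s)
  then h.toLp else 0

/-- A range function is a map from `𝕋ⁿ` to the closed subspaces of `ℓ²_s`. -/
abbrev RangeFunction (n : ℕ) (s : ℝ) : Type := cube n → ClosedSubmodule ℂ (SeqSpace n s)

/-- A range function is measurable if the orthogonal projections `P(t)` onto its values are weakly
measurable: `t ↦ ⟨P(t) a, b⟩` is Lebesgue measurable for all `a, b ∈ ℓ²_s`. -/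
def RangeFunction.IsMeasurable {n : ℕ} {s : ℝ} (J : RangeFunction n s) : Prop :=
  ∀ a b : SeqSpace n s,
    AEMeasurable (fun t => inner ℂ b ((J t).toSubmodule.starProjection a)) volume

/-- `J` is the range function of `V`: it is measurable and
`V = {f ∈ H^s : 𝒯_s f(t) ∈ J(t) for a.e. t}`. -/
structure IsRangeFunctionOf {n : ℕ} {s : ℝ} (J : RangeFunction n s)
    (V : Submodule ℂ (Sobolev n s)) : Prop where
  measurable : J.IsMeasurable
  mem_iff : ∀ f : Sobolev n s, f ∈ V ↔ ∀ᵐ t : cube n, fiber f t ∈ J t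

/-- A bounded operator from a closed subspace of `ℓ²_s` to `ℓ²_s`. -/
structure PartialOp (n : ℕ) (s : ℝ) where
  /-- the domain -/
  dom : ClosedSubmodule ℂ (SeqSpace n s)
  /-- the operator -/
  op : dom.toSubmodule →L[ℂ] SeqSpace n s

/-- A range operator on `J` is a map `R` from `𝕋ⁿ` to the bounded operators on closed subspaces of
`ℓ²_s` such that the domain of `R(t)` is `J(t)` for a.e. `t`. -/
def IsRangeOperatorOn {n : ℕ} {s : ℝ} (J : RangeFunction n s) (R : cube n → PartialOp n s) : Prop :=
  ∀ᵐ t : cube n, (R t).dom = J t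

/-- A range operator is measurable if `t ↦ R(t) P(t)` is weakly measurable, where `P(t)` is the
orthogonal projection onto the domain of `R(t)`. -/
def IsMeasurableRangeOperator {n : ℕ} {s : ℝ} (R : cube n → PartialOp n s) : Prop :=
  ∀ a b : SeqSpace n s,
    AEMeasurable (fun t => inner ℂ b ((R t).op ((R t).dom.toSubmodule.orthogonalProjectionOnto a)))
      volume

/-- The relation `𝒯_s(L f)(t) = R(t)(𝒯_s f(t))` for a.e. `t`, for every `f ∈ V`. -/
def Corresponds {n : ℕ} {s : ℝ} {V : Submodule ℂ (Sobolev n s)} (L : V →L[ℂ] Sobolev n s)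
    (R : cube n → PartialOp n s) : Prop :=
  ∀ f : V, ∀ᵐ t : cube n, ∃ h : fiber (f : Sobolev n s) t ∈ (R t).dom,
    fiber (L f) t = (R t).op ⟨fiber (f : Sobolev n s) t, h⟩

end ShiftInv

end

noncomputable section

namespace ShiftInv

variable {n : ℕ} {s : ℝ}

/-! The map `f ↦ μ_s f̂` is unitary from `H^s` onto `L²(ℝⁿ)`. Cutting `ℝⁿ` into integer translates
of the cube makes fiberization unitary from `H^s` onto `L²(𝕋ⁿ; ℓ²_s)`: it is isometric by
`lintegral_enorm_fiber_sq` and onto by `exists_fiber_ae_eq`. Under it `T_k` becomes multiplication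
by the scalar character `e^{-2πi⟨t, k⟩}` (`fiber_shift`).

Hence the numbers `⟨h, T_k f⟩` are the Fourier coefficients of the integrable function `t ↦ ⟨𝒯h(t),
𝒯f(t)⟩`. Since these coefficients determine the function (`ae_eq_zero_of_integral_phase_mul`), a
scalar identity that persists under all shifts holds fiber by fiber.

Applied to `h ⊥ V`, this shows that the fibers of `Vᗮ` are orthogonal to those of `V`, so the closed
span of the fibers of a dense sequence of `V` is a range function. Applied to `L` and its adjoint,
it gives `⟨𝒯h(t), 𝒯(Lf)(t)⟩ = ⟨𝒯u(t), 𝒯f(t)⟩` with `u = L*h` (`exists_fiber_adjoint`), so `𝒯(Lf)(t)`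
depends on `𝒯f(t)` alone. Norm relations for `L` then localize to every measurable subset of the
cube and hold pointwise.

The null sets stay under control because `ℓ²_s` is separable: the projections to `J(t)` of one dense
sequence are fibers of countably many elements of `V` and are dense in `J(t)`. They define `R(t)` by
continuous extension and determine it uniquely. Conversely, a bounded measurable `R` acts on the
fibers, and it commutes with the characters because each `R(t)` is linear. -/

theorem weight_pos (r : ℝ) (x : Rn n) : 0 < weight r x := by
  unfold weight
  positivity

theorem weight_mul_weight_neg (r : ℝ) :
    ((fun x : Rn n => (weight r x : ℂ)) * fun x => (weight (-r) x : ℂ)) = fun _ => 1 := by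
  ext x
  have hx : (0 : ℝ) < 1 + ‖x‖ ^ 2 := by positivity
  simp only [weight, Pi.mul_apply]
  rw [← Complex.ofReal_mul, ← Real.rpow_add hx]
  simp [neg_div]

/-! ### The unitary map from `H^s` onto `L²` -/

namespace Sobolev

/-- Division by `μ_s` is multiplication by `μ_{-s}`, which has temperate growth and so acts on all
tempered distributions. -/
theorem weightedFourier_surjective :
    Function.Surjective (weightedFourier : Sobolev n s → Lp ℂ 2 (volume : Measure (Rn n))) := by
  intro g
  let u : 𝓢'(Rn n, ℂ) := 𝓕⁻ (smulLeftCLM ℂ (fun x => (weight (-s) x : ℂ))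
    (Lp.toTemperedDistributionCLM ℂ (volume : Measure (Rn n)) 2 g))
  have hu : smulLeftCLM ℂ (fun x => (weight s x : ℂ)) (𝓕 u) =
      Lp.toTemperedDistributionCLM ℂ (volume : Measure (Rn n)) 2 g := by
    simp only [u, fourier_fourierInv_eq]
    rw [smulLeftCLM_smulLeftCLM_apply (weight_hasTemperateGrowth _) (weight_hasTemperateGrowth _),
      mul_comm, weight_mul_weight_neg, smulLeftCLM_const, one_smul]
  let f : Sobolev n s := ⟨u, memSobolev_iff_exists_smulLeftCLM_fourier.2 ⟨g, hu⟩⟩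
  exact ⟨f, toTemperedDistributionCLM_injective
    ((toTemperedDistributionCLM_weightedFourier f).trans hu)⟩

/-- The isometric isomorphism `f ↦ μ_s f̂` of `H^s` onto `L²`. -/
def weightedFourierEquiv : Sobolev n s ≃ₗᵢ[ℂ] Lp ℂ 2 (volume : Measure (Rn n)) where
  toLinearEquiv := LinearEquiv.ofBijective weightedFourier
    ⟨weightedFourier_injective, weightedFourier_surjective⟩
  norm_map' _ := rfl

instance : CompleteSpace (Sobolev n s) :=
  (completeSpace_congr (e := (weightedFourierEquiv (n := n) (s := s)).toEquiv)
    (weightedFourierEquiv (n := n) (s := s)).isometry.isUniformEmbedding).2 inferInstance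

instance : SecondCountableTopology (Sobolev n s) :=
  haveI : Fact ((2 : ℝ≥0∞) ≠ ∞) := ⟨by simp⟩
  (weightedFourierEquiv (n := n) (s := s)).toHomeomorph.secondCountableTopology

/-- Translation is the Fourier multiplier with a bounded smooth symbol, which commutes with the
weight. The identity between distributions passes to `L²` because `L²` embeds into them. -/
theorem weightedFourier_shift (k : Zn n) (f : Sobolev n s) :
    ∀ᵐ x : Rn n, weightedFourier (f.shift k) x =
      (Real.fourierChar (-inner ℝ x (latticePt k)) : ℂ) * weightedFourier f x := by
  have hg := phase_hasTemperateGrowth (latticePt k)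
  set g : Rn n → ℂ := fun x => (Real.fourierChar (-inner ℝ x (latticePt k)) : ℂ) with hgdef
  have hgtop : MemLp g ∞ (volume : Measure (Rn n)) :=
    memLp_top_of_bound hg.1.continuous.aestronglyMeasurable 1
      (Filter.Eventually.of_forall fun x => (Circle.norm_coe _).le)
  have key : weightedFourier (f.shift k) = hgtop.toLp g • weightedFourier f := by
    apply toTemperedDistributionCLM_injective
    rw [toTemperedDistributionCLM_weightedFourier]
    have h1 : toDist (f.shift k) = fourierMultiplierCLM ℂ g (toDist f) := translateDist_eq _ _
    have h2 := Lp.toTemperedDistribution_smul_eq (r := 2) hg hgtop (weightedFourier f)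
    rw [Lp.toTemperedDistributionCLM_apply, h2, ← Lp.toTemperedDistributionCLM_apply,
      toTemperedDistributionCLM_weightedFourier, h1, fourierMultiplierCLM_apply,
      fourier_fourierInv_eq, smulLeftCLM_smulLeftCLM_apply hg (weight_hasTemperateGrowth _),
      smulLeftCLM_smulLeftCLM_apply (weight_hasTemperateGrowth _) hg, mul_comm]
  rw [key]
  filter_upwards [Lp.coeFn_lpSMul (r := 2) (hgtop.toLp g) (weightedFourier f), hgtop.coeFn_toLp]
    with x h1 h2
  rw [h1, Pi.smul_apply', h2, smul_eq_mul]

end Sobolev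

/-! ### The tiling of `ℝⁿ` by the translates of the cube -/

theorem measurableSet_cube : MeasurableSet (cube n) := by
  have : cube n = ⋂ i, (fun t : Rn n => t i) ⁻¹' Set.Ico (-(1 / 2) : ℝ) (1 / 2) := by
    ext t; simp [cube]
  rw [this]
  exact MeasurableSet.iInter fun i => measurableSet_Ico.preimage (by fun_prop)

theorem volume_cube_ne_top : volume (cube n) ≠ ∞ := by
  have : cube n ⊆ Metric.closedBall 0 (√n) := by
    intro t ht
    rw [mem_closedBall_zero_iff, EuclideanSpace.norm_eq]
    apply Real.sqrt_le_sqrt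
    calc ∑ i, ‖t i‖ ^ 2 ≤ ∑ _i : Fin n, (1 : ℝ) := by
          refine Finset.sum_le_sum fun i _ => ?_
          have := ht i
          rw [Set.mem_Ico] at this
          rw [Real.norm_eq_abs, sq_abs]
          nlinarith
      _ = n := by simp
  exact ((measure_mono this).trans_lt measure_closedBall_lt_top).ne

instance : IsFiniteMeasure (volume : Measure (cube n)) := by
  refine ⟨?_⟩
  rw [Measure.Subtype.volume_univ measurableSet_cube.nullMeasurableSet]
  exact volume_cube_ne_top.lt_top

/-- The integer part of `x`, taken with respect to the cube `[-1/2, 1/2)ⁿ`. -/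
def latticePart (x : Rn n) : Zn n := fun i => ⌊x i + 1 / 2⌋

theorem measurable_latticePart : Measurable (latticePart : Rn n → Zn n) := by
  unfold latticePart
  refine measurable_pi_lambda _ fun i => ?_
  have : Measurable fun x : Rn n => x i + 1 / 2 := by fun_prop
  exact this.floor

theorem sub_latticePart_mem_cube (x : Rn n) : x - latticePt (latticePart x) ∈ cube n := by
  intro i
  have h1 := Int.floor_le (x i + 1 / 2)
  have h2 := Int.lt_floor_add_one (x i + 1 / 2)
  simp only [latticePt, latticePart, PiLp.sub_apply, Set.mem_Ico]
  constructor <;> linarith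

theorem latticePart_add (t : cube n) (k : Zn n) : latticePart ((t : Rn n) + latticePt k) = k := by
  ext i
  have h := t.2 i
  rw [Set.mem_Ico] at h
  simp only [latticePart, latticePt, PiLp.add_apply]
  rw [Int.floor_eq_iff]
  constructor <;> linarith

/-- The fractional part of `x` in the cube. -/
def cubePart (x : Rn n) : cube n := ⟨x - latticePt (latticePart x), sub_latticePart_mem_cube x⟩

theorem measurable_latticePt : Measurable (latticePt : Zn n → Rn n) := Measurable.of_discrete

theorem measurable_cubePart : Measurable (cubePart : Rn n → cube n) :=
  (measurable_id.sub (measurable_latticePt.comp measurable_latticePart)).subtype_mk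

theorem cubePart_add (t : cube n) (k : Zn n) : cubePart ((t : Rn n) + latticePt k) = t := by
  ext1
  simp [cubePart, latticePart_add]

/-- The level sets of `latticePart` are the disjoint translates of the cube. -/
theorem lintegral_eq_lintegral_cube_tsum {g : Rn n → ℝ≥0∞} (hg : Measurable g) :
    ∫⁻ x, g x = ∫⁻ t : cube n, ∑' k : Zn n, g ((t : Rn n) + latticePt k) := by
  have hm (k : Zn n) : MeasurableSet (latticePart ⁻¹' {k} : Set (Rn n)) :=
    measurable_latticePart (measurableSet_singleton k)
  have hU : (⋃ k : Zn n, (latticePart ⁻¹' {k} : Set (Rn n))) = Set.univ := by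
    ext x; simp
  rw [← setLIntegral_univ, ← hU, lintegral_iUnion hm, lintegral_tsum]
  · congr 1
    ext k
    have hmp := measurePreserving_add_right (volume : Measure (Rn n)) (latticePt k)
    rw [← hmp.setLIntegral_comp_preimage (hm k) hg]
    have hpre : (fun x => x + latticePt k) ⁻¹' (latticePart ⁻¹' {k}) = cube n := by
      ext x
      constructor
      · intro hx
        have := sub_latticePart_mem_cube (x + latticePt k)
        rw [Set.mem_preimage, Set.mem_preimage, Set.mem_singleton_iff] at hx
        simpa [hx] using this
      · intro hx
        exact latticePart_add ⟨x, hx⟩ k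
    rw [hpre]
    exact (lintegral_subtype_comap measurableSet_cube _).symm
  · intro k
    exact (hg.comp (measurable_subtype_coe.add_const _)).aemeasurable
  · intro i j hij
    exact Disjoint.preimage _ (Set.disjoint_singleton.2 hij)

theorem ae_cube_of_ae {p : Rn n → Prop} (h : ∀ᵐ x, p x) :
    ∀ᵐ t : cube n, ∀ k : Zn n, p ((t : Rn n) + latticePt k) := by
  rw [ae_all_iff]
  intro k
  have h1 := (measurePreserving_add_right (volume : Measure (Rn n))
    (latticePt k)).quasiMeasurePreserving.ae h
  have h2 := (ae_restrict_iff_subtype (μ := volume) measurableSet_cube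
    (p := fun x : Rn n => p (x + latticePt k))).1 (ae_restrict_of_ae h1)
  exact h2

end ShiftInv

namespace ShiftInv

/-! ### Measurability in separable Hilbert spaces and square-integrable functions -/

section Hilbert

variable {X H : Type*} [MeasurableSpace X] {μ : Measure X} [NormedAddCommGroup H]

theorem eLpNorm_two_sq (f : X → H) : eLpNorm f 2 μ ^ 2 = ∫⁻ x, ‖f x‖ₑ ^ 2 ∂μ := by
  have h := eLpNorm_nnreal_pow_eq_lintegral (f := f) (μ := μ) (p := 2) (by simp)
  simpa only [NNReal.coe_ofNat, ENNReal.coe_ofNat, ENNReal.rpow_ofNat] using h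

theorem memLp_two_of_lintegral_lt_top {f : X → H} (hf : AEStronglyMeasurable f μ)
    (h : ∫⁻ x, ‖f x‖ₑ ^ 2 ∂μ < ∞) : MemLp f 2 μ := by
  refine ⟨hf, ?_⟩
  rw [← eLpNorm_two_sq] at h
  by_contra h'
  rw [not_lt, top_le_iff] at h'
  simp [h'] at h

variable [InnerProductSpace ℂ H]

theorem countable_of_orthonormal [SecondCountableTopology H] {ι : Type*} {e : ι → H}
    (he : Orthonormal ℂ e) : Countable ι := by
  refine Pairwise.countable_of_isOpen_disjoint (s := fun i => Metric.ball (e i) (1 / 2)) ?_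
    (fun _ => Metric.isOpen_ball) (fun i => ⟨e i, Metric.mem_ball_self (by norm_num)⟩)
  intro i j hij
  refine Metric.ball_disjoint_ball ?_
  -- Distinct orthonormal vectors are at distance `√2 > 1`, so balls of radius `1/2` around them are
  -- disjoint.
  have h := norm_sub_sq (𝕜 := ℂ) (e i) (e j)
  rw [he.2 hij, he.1, he.1] at h
  rw [dist_eq_norm]
  norm_num at h ⊢
  nlinarith [norm_nonneg (e i - e j)]

/-- Pettis' theorem in a separable Hilbert space: the expansion in a countable orthonormal basis is
a limit of measurable finite sums. -/
theorem aestronglyMeasurable_of_inner [CompleteSpace H] [SecondCountableTopology H] {f : X → H}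
    (hf : ∀ b, AEMeasurable (fun x => inner ℂ b (f x)) μ) : AEStronglyMeasurable f μ := by
  obtain ⟨w, b, -⟩ := exists_hilbertBasis ℂ H
  have : Countable w := countable_of_orthonormal b.orthonormal
  refine aestronglyMeasurable_of_tendsto_ae (Filter.atTop : Filter (Finset w))
    (f := fun S x => ∑ i ∈ S, inner ℂ (b i) (f x) • b i) (fun S => ?_)
    (Filter.Eventually.of_forall fun x => ?_)
  · refine Finset.aestronglyMeasurable_fun_sum S fun i _ => ?_
    exact (hf (b i)).aestronglyMeasurable.smul_const _
  · have := b.hasSum_repr (f x)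
    simp only [HilbertBasis.repr_apply_apply] at this
    exact this

end Hilbert

variable {n : ℕ} {s : ℝ}

/-! ### The sequence space -/

instance : SecondCountableTopology (SeqSpace n s) :=
  haveI : Fact ((2 : ℝ≥0∞) ≠ ∞) := ⟨by simp⟩
  haveI : SFinite (weightedCount n s) := by unfold weightedCount; infer_instance
  inferInstance

instance : SFinite (weightedCount n s) := by unfold weightedCount; infer_instance

theorem weightedCount_singleton (k : Zn n) :
    weightedCount n s {k} = ENNReal.ofReal (weight s (latticePt k) ^ 2) := by
  rw [weightedCount, withDensity_apply _ (measurableSet_singleton k)]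
  simp

theorem eq_of_ae_weightedCount {E : Type*} {c d : Zn n → E} (h : c =ᵐ[weightedCount n s] d) :
    c = d := by
  ext k
  by_contra hk
  have h1 : weightedCount n s {k} ≤ 0 := by
    rw [← ae_iff.1 h]
    exact measure_mono (by simpa using hk)
  rw [weightedCount_singleton] at h1
  have := weight_pos s (latticePt k)
  have h2 : (0 : ℝ) < weight s (latticePt k) ^ 2 := by positivity
  simp at h1
  linarith

theorem lintegral_weightedCount (g : Zn n → ℝ≥0∞) :
    ∫⁻ k, g k ∂weightedCount n s = ∑' k, ENNReal.ofReal (weight s (latticePt k) ^ 2) * g k := by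
  rw [weightedCount, lintegral_withDensity_eq_lintegral_mul _ Measurable.of_discrete
    Measurable.of_discrete, lintegral_count]
  rfl

theorem SeqSpace.enorm_sq (c : SeqSpace n s) :
    ‖c‖ₑ ^ 2 = ∑' k, ENNReal.ofReal (weight s (latticePt k) ^ 2) * ‖c k‖ₑ ^ 2 := by
  rw [Lp.enorm_def, eLpNorm_two_sq, lintegral_weightedCount]

/-- The division by `μ_s(k)` in the fiber cancels the mass of `k` in `ℓ²_s`; this is what makes
fiberization isometric. -/
theorem enorm_weight_sq_mul (k : Zn n) (z : ℂ) :
    ENNReal.ofReal (weight s (latticePt k) ^ 2) * ‖z / (weight s (latticePt k) : ℂ)‖ₑ ^ 2 =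
      ‖z‖ₑ ^ 2 := by
  have h := weight_pos s (latticePt k)
  rw [← ofReal_norm, ← ofReal_norm, ← ENNReal.ofReal_pow (norm_nonneg _),
    ← ENNReal.ofReal_pow (norm_nonneg _), ← ENNReal.ofReal_mul (by positivity)]
  congr 1
  rw [norm_div, Complex.norm_real, Real.norm_eq_abs, abs_of_pos h]
  field_simp

/-- The point evaluations of the sequence space are continuous. -/
theorem SeqSpace.eval_eq_inner (k : Zn n) : ∃ b : SeqSpace n s, ∀ c : SeqSpace n s,
    c k = inner ℂ b c := by
  have hk : weightedCount n s {k} ≠ ∞ := by simp [weightedCount_singleton]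
  have hw := weight_pos s (latticePt k)
  let r : ℝ := (weight s (latticePt k) ^ 2)⁻¹
  refine ⟨(r : ℂ) • indicatorConstLp 2 (measurableSet_singleton k) hk (1 : ℂ), fun c => ?_⟩
  rw [inner_smul_left, L2.inner_indicatorConstLp_one, integral_singleton, Measure.real,
    weightedCount_singleton, ENNReal.toReal_ofReal (by positivity)]
  simp only [Complex.conj_ofReal, Complex.real_smul, r]
  rw [← mul_assoc, ← Complex.ofReal_mul, inv_mul_cancel₀ (by positivity)]
  simp

/-! ### The fiberization as an isometry -/

/-- The sequence whose class is `fiber f t`. -/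
def fiberSeq (f : Sobolev n s) (t : cube n) (k : Zn n) : ℂ :=
  Sobolev.weightedFourier f ((t : Rn n) + latticePt k) / (weight s (latticePt k) : ℂ)

theorem measurable_fiberSeq (f : Sobolev n s) :
    Measurable fun p : cube n × Zn n => fiberSeq f p.1 p.2 := by
  have h1 := (Lp.stronglyMeasurable (Sobolev.weightedFourier f)).measurable
  have h2 : Measurable fun p : cube n × Zn n => (p.1 : Rn n) + latticePt p.2 :=
    (measurable_subtype_coe.comp measurable_fst).add (measurable_latticePt.comp measurable_snd)
  have h3 : Measurable fun p : cube n × Zn n => (weight s (latticePt p.2) : ℂ) :=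
    (Measurable.of_discrete (f := fun k : Zn n => (weight s (latticePt k) : ℂ))).comp measurable_snd
  exact (h1.comp h2).div h3

theorem eLpNorm_fiberSeq_sq (f : Sobolev n s) (t : cube n) :
    eLpNorm (fiberSeq f t) 2 (weightedCount n s) ^ 2 =
      ∑' k, ‖Sobolev.weightedFourier f ((t : Rn n) + latticePt k)‖ₑ ^ 2 := by
  rw [eLpNorm_two_sq, lintegral_weightedCount]
  simp only [fiberSeq, enorm_weight_sq_mul]

theorem lintegral_eLpNorm_fiberSeq (f : Sobolev n s) :
    ∫⁻ t : cube n, eLpNorm (fiberSeq f t) 2 (weightedCount n s) ^ 2 = ‖f‖ₑ ^ 2 := by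
  have h : ‖f‖ₑ = ‖Sobolev.weightedFourier f‖ₑ := rfl
  rw [h, Lp.enorm_def, eLpNorm_two_sq,
    lintegral_eq_lintegral_cube_tsum ((Lp.stronglyMeasurable _).measurable.enorm.pow_const 2)]
  simp only [eLpNorm_fiberSeq_sq]

theorem ae_memLp_fiberSeq (f : Sobolev n s) :
    ∀ᵐ t : cube n, MemLp (fiberSeq f t) 2 (weightedCount n s) := by
  have h1 : ∫⁻ t : cube n, eLpNorm (fiberSeq f t) 2 (weightedCount n s) ^ 2 ≠ ∞ := by
    rw [lintegral_eLpNorm_fiberSeq]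
    simp
  have h2 : AEMeasurable (fun t : cube n => eLpNorm (fiberSeq f t) 2 (weightedCount n s) ^ 2) := by
    simp only [eLpNorm_fiberSeq_sq]
    refine (Measurable.tsum fun k => ?_).aemeasurable
    exact ((Lp.stronglyMeasurable _).measurable.comp
      (measurable_subtype_coe.add_const _)).enorm.pow_const 2
  filter_upwards [ae_lt_top' h2 h1] with t ht
  refine ⟨Measurable.of_discrete.aestronglyMeasurable, ?_⟩
  by_contra h'
  rw [not_lt, top_le_iff] at h'
  simp [h'] at ht

theorem fiber_eq_toLp {f : Sobolev n s} {t : cube n}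
    (h : MemLp (fiberSeq f t) 2 (weightedCount n s)) : fiber f t = h.toLp := dif_pos h

theorem fiber_apply {f : Sobolev n s} {t : cube n}
    (h : MemLp (fiberSeq f t) 2 (weightedCount n s)) : ⇑(fiber f t) = fiberSeq f t := by
  rw [fiber_eq_toLp h]
  exact eq_of_ae_weightedCount h.coeFn_toLp

theorem SeqSpace.ext {c d : SeqSpace n s} (h : ∀ k, c k = d k) : c = d :=
  Lp.ext (Filter.Eventually.of_forall h)

theorem SeqSpace.add_apply (c d : SeqSpace n s) (k : Zn n) : (c + d) k = c k + d k :=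
  congrFun (eq_of_ae_weightedCount (Lp.coeFn_add c d)) k

theorem SeqSpace.smul_apply (z : ℂ) (c : SeqSpace n s) (k : Zn n) : (z • c) k = z * c k :=
  congrFun (eq_of_ae_weightedCount (Lp.coeFn_smul z c)) k

theorem ae_fiber_apply (f : Sobolev n s) : ∀ᵐ t : cube n, ∀ k, fiber f t k =
    Sobolev.weightedFourier f ((t : Rn n) + latticePt k) / (weight s (latticePt k) : ℂ) := by
  filter_upwards [ae_memLp_fiberSeq f] with t ht k
  rw [fiber_apply ht, fiberSeq]

theorem fiber_add (f g : Sobolev n s) :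
    ∀ᵐ t : cube n, fiber (f + g) t = fiber f t + fiber g t := by
  have h := ae_cube_of_ae (Lp.coeFn_add (Sobolev.weightedFourier f) (Sobolev.weightedFourier g))
  rw [← map_add] at h
  filter_upwards [ae_fiber_apply f, ae_fiber_apply g, ae_fiber_apply (f + g), h]
    with t h1 h2 h3 h4
  refine SeqSpace.ext fun k => ?_
  rw [SeqSpace.add_apply, h1, h2, h3, h4, Pi.add_apply, add_div]

theorem fiber_smul (z : ℂ) (f : Sobolev n s) :
    ∀ᵐ t : cube n, fiber (z • f) t = z • fiber f t := by
  have h := ae_cube_of_ae (Lp.coeFn_smul z (Sobolev.weightedFourier f))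
  rw [← map_smul] at h
  filter_upwards [ae_fiber_apply f, ae_fiber_apply (z • f), h] with t h1 h2 h3
  refine SeqSpace.ext fun k => ?_
  rw [SeqSpace.smul_apply, h1, h2, h3, Pi.smul_apply, smul_eq_mul, mul_div_assoc]

/-- The character `t ↦ e^{-2πi⟨t, k⟩}` on the cube. -/
def phase (k : Zn n) (t : cube n) : ℂ := Real.fourierChar (-inner ℝ (t : Rn n) (latticePt k))

/-- Lattice points have integer inner products. Hence a shift multiplies all coordinates of a fiber
by the same scalar. -/
theorem fourierChar_add_latticePt (x : Rn n) (k m : Zn n) :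
    (Real.fourierChar (-inner ℝ (x + latticePt m) (latticePt k)) : ℂ) =
      Real.fourierChar (-inner ℝ x (latticePt k)) := by
  have h : inner ℝ (latticePt m) (latticePt k) = ((∑ i, m i * k i : ℤ) : ℝ) := by
    simp [latticePt, PiLp.inner_apply, mul_comm]
  rw [inner_add_left, h, neg_add, AddChar.map_add_eq_mul]
  have h1 : (Real.fourierChar (-((∑ i, m i * k i : ℤ) : ℝ)) : ℂ) = 1 := by
    rw [Real.fourierChar_apply, Complex.exp_eq_one_iff]
    exact ⟨-∑ i, m i * k i, by push_cast; ring⟩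
  rw [Circle.coe_mul, h1, mul_one]

theorem fiber_shift (k : Zn n) (f : Sobolev n s) :
    ∀ᵐ t : cube n, fiber (f.shift k) t = phase k t • fiber f t := by
  filter_upwards [ae_fiber_apply f, ae_fiber_apply (f.shift k),
    ae_cube_of_ae (Sobolev.weightedFourier_shift k f)] with t h1 h2 h3
  refine SeqSpace.ext fun m => ?_
  rw [SeqSpace.smul_apply, h1, h2, h3, fourierChar_add_latticePt, mul_div_assoc, phase]

theorem aestronglyMeasurable_fiber (f : Sobolev n s) :
    AEStronglyMeasurable (fiber f) (volume : Measure (cube n)) := by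
  refine aestronglyMeasurable_of_inner fun b => ?_
  have h : Measurable fun t : cube n =>
      ∫ k, inner ℂ (b k) (fiberSeq f t k) ∂weightedCount n s := by
    refine (StronglyMeasurable.integral_prod_right' (f := fun p : cube n × Zn n =>
      inner ℂ (b p.2) (fiberSeq f p.1 p.2)) ?_).measurable
    refine Measurable.stronglyMeasurable (Measurable.inner ?_ (measurable_fiberSeq f))
    exact (Measurable.of_discrete (f := fun k => b k)).comp measurable_snd
  refine h.aemeasurable.congr ?_
  filter_upwards [ae_memLp_fiberSeq f] with t ht
  rw [L2.inner_def, fiber_apply ht]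

theorem lintegral_enorm_fiber_sq (f : Sobolev n s) : ∫⁻ t, ‖fiber f t‖ₑ ^ 2 = ‖f‖ₑ ^ 2 := by
  rw [← lintegral_eLpNorm_fiberSeq]
  refine lintegral_congr_ae ?_
  filter_upwards [ae_memLp_fiberSeq f] with t ht
  rw [fiber_eq_toLp ht, Lp.enorm_toLp]

theorem memLp_fiber (f : Sobolev n s) : MemLp (fiber f) 2 (volume : Measure (cube n)) := by
  refine memLp_two_of_lintegral_lt_top (aestronglyMeasurable_fiber f) ?_
  rw [lintegral_enorm_fiber_sq]
  simp

/-- The fiberization, as an isometry into `L²(𝕋ⁿ; ℓ²_s)`. -/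
def fiberIsometry : Sobolev n s →ₗᵢ[ℂ] Lp (SeqSpace n s) 2 (volume : Measure (cube n)) where
  toFun f := (memLp_fiber f).toLp
  map_add' f g := by
    rw [← MemLp.toLp_add]
    exact MemLp.toLp_congr _ _ (fiber_add f g)
  map_smul' z f := by
    rw [RingHom.id_apply, ← MemLp.toLp_const_smul]
    exact MemLp.toLp_congr _ _ (fiber_smul z f)
  norm_map' f := by
    have h : ‖(memLp_fiber f).toLp‖ₑ ^ 2 = ‖f‖ₑ ^ 2 := by
      rw [Lp.enorm_toLp, eLpNorm_two_sq, lintegral_enorm_fiber_sq]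
    have h' : ‖(memLp_fiber f).toLp‖ₑ = ‖f‖ₑ := by
      simpa using (ENNReal.pow_right_strictMono two_ne_zero).injective h
    simpa using congrArg ENNReal.toReal h'

theorem coeFn_fiberIsometry (f : Sobolev n s) : fiberIsometry f =ᵐ[volume] fiber f :=
  (memLp_fiber f).coeFn_toLp

theorem eq_of_fiber_ae_eq {f g : Sobolev n s} (h : ∀ᵐ t : cube n, fiber f t = fiber g t) :
    f = g :=
  fiberIsometry.injective (MemLp.toLp_congr (memLp_fiber f) (memLp_fiber g) h)

theorem inner_eq_integral_inner_fiber (f g : Sobolev n s) :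
    inner ℂ f g = ∫ t : cube n, inner ℂ (fiber f t) (fiber g t) := by
  rw [← fiberIsometry.inner_map_map, L2.inner_def]
  refine integral_congr_ae ?_
  filter_upwards [coeFn_fiberIsometry f, coeFn_fiberIsometry g] with t h1 h2
  rw [h1, h2]

theorem integrable_inner_fiber (f g : Sobolev n s) :
    Integrable (fun t : cube n => inner ℂ (fiber f t) (fiber g t)) := by
  refine (L2.integrable_inner (𝕜 := ℂ) (fiberIsometry f) (fiberIsometry g)).congr ?_
  filter_upwards [coeFn_fiberIsometry f, coeFn_fiberIsometry g] with t h1 h2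
  rw [h1, h2]

/-- Every square-integrable function on the cube with values in `ℓ²_s` is a fiberization. -/
theorem exists_fiber_ae_eq {G : cube n → SeqSpace n s} (hG : MemLp G 2 volume) :
    ∃ f : Sobolev n s, ∀ᵐ t : cube n, fiber f t = G t := by
  obtain ⟨G', hG'm, hGG'⟩ := hG.1
  -- The candidate for `μ_s f̂`: the coordinates of `G'` are spread over the translates of the cube,
  -- and the division by `μ_s(k)` is undone.
  let w : Rn n → ℂ := fun x =>
    G' (cubePart x) (latticePart x) * (weight s (latticePt (latticePart x)) : ℂ)
  have hw : Measurable w := by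
    have h1 : Measurable fun p : cube n × Zn n =>
        G' p.1 p.2 * (weight s (latticePt p.2) : ℂ) := by
      refine measurable_from_prod_countable_left fun k => ?_
      obtain ⟨b, hb⟩ := SeqSpace.eval_eq_inner (s := s) k
      simp only [hb]
      exact (stronglyMeasurable_const.inner hG'm).measurable.mul_const _
    exact h1.comp (measurable_cubePart.prodMk measurable_latticePart)
  have hwt (t : cube n) (k : Zn n) :
      w ((t : Rn n) + latticePt k) = G' t k * (weight s (latticePt k) : ℂ) := by
    simp only [w, cubePart_add, latticePart_add]
  have hwk (k : Zn n) : (weight s (latticePt k) : ℂ) ≠ 0 :=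
    Complex.ofReal_ne_zero.2 (weight_pos s _).ne'
  have hw2 : MemLp w 2 volume := by
    refine memLp_two_of_lintegral_lt_top hw.aestronglyMeasurable ?_
    rw [lintegral_eq_lintegral_cube_tsum (hw.enorm.pow_const 2)]
    have : ∫⁻ t : cube n, ∑' k, ‖w ((t : Rn n) + latticePt k)‖ₑ ^ 2 =
        ∫⁻ t : cube n, ‖G t‖ₑ ^ 2 := by
      refine lintegral_congr_ae ?_
      filter_upwards [hGG'] with t ht
      rw [ht, SeqSpace.enorm_sq]
      congr 1
      ext k
      rw [hwt, ← enorm_weight_sq_mul (s := s) k (_ * _), mul_div_cancel_right₀ _ (hwk k)]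
    rw [this, ← eLpNorm_two_sq]
    exact ENNReal.pow_lt_top hG.2
  obtain ⟨f, hf⟩ := Sobolev.weightedFourier_surjective (s := s) hw2.toLp
  refine ⟨f, ?_⟩
  have h := ae_cube_of_ae hw2.coeFn_toLp
  rw [← hf] at h
  filter_upwards [hGG', ae_fiber_apply f, h] with t h1 h2 h3
  refine SeqSpace.ext fun k => ?_
  rw [h2, h3, hwt, h1, mul_div_cancel_right₀ _ (hwk k)]

end ShiftInv

namespace ShiftInv

variable {n : ℕ}

/-! ### Uniqueness of Fourier coefficients on the cube -/

/-- The identification of the cube with the torus `(ℝ/ℤ)ⁿ`. -/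
def toTorus (t : cube n) : UnitAddTorus (Fin n) := fun i => ((t : Rn n) i : UnitAddCircle)

theorem continuous_toTorus : Continuous (toTorus : cube n → UnitAddTorus (Fin n)) := by
  refine continuous_pi fun i => ?_
  exact (AddCircle.continuous_mk' 1).comp (by fun_prop)

theorem mFourier_toTorus (k : Zn n) (t : cube n) :
    UnitAddTorus.mFourier k (toTorus t) = phase (-k) t := by
  have h : -inner ℝ (t : Rn n) (latticePt (-k)) = ∑ i, (k i : ℝ) * (t : Rn n) i := by
    simp [latticePt, PiLp.inner_apply]
  rw [phase, h, Real.fourierChar_apply]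
  simp only [UnitAddTorus.mFourier, ContinuousMap.coe_mk, toTorus, fourier_coe_apply]
  rw [← Complex.exp_sum]
  congr 1
  push_cast
  rw [Finset.mul_sum, Finset.sum_mul]
  refine Finset.sum_congr rfl fun i _ => ?_
  ring

theorem norm_phase (k : Zn n) (t : cube n) : ‖phase k t‖ = 1 := Circle.norm_coe _

/-- The map to the torus has a measurable left inverse, so no measurable set of the cube is lost by
passing to the torus. -/
theorem exists_preimage_toTorus {E : Set (cube n)} (hE : MeasurableSet E) :
    ∃ B : Set (UnitAddTorus (Fin n)), MeasurableSet B ∧ E = toTorus ⁻¹' B := by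
  obtain ⟨S, hS, rfl⟩ := hE
  let r : UnitAddTorus (Fin n) → Rn n := fun x =>
    WithLp.toLp 2 fun i => (AddCircle.measurableEquivIco 1 (-(1 / 2) : ℝ) (x i) : ℝ)
  have hr : Measurable r := by
    refine (WithLp.measurable_toLp 2 (Fin n → ℝ)).comp (measurable_pi_lambda _ fun i => ?_)
    exact measurable_subtype_coe.comp
      ((AddCircle.measurableEquivIco 1 (-(1 / 2) : ℝ)).measurable.comp (measurable_pi_apply i))
  refine ⟨r ⁻¹' S, hr hS, ?_⟩
  have hrt (t : cube n) : r (toTorus t) = t := by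
    ext i
    have h : (t : Rn n) i ∈ Set.Ico (-(1 / 2) : ℝ) (-(1 / 2) + 1) := by
      have := t.2 i
      norm_num at this ⊢
      exact this
    exact congrArg Subtype.val (AddCircle.equivIco_coe_eq h)
  ext t
  simp [hrt]

/-- Integration against an `L¹` function is continuous in the sup norm, and trigonometric
polynomials are dense in the continuous functions on the torus. -/
theorem integral_comp_toTorus_mul_eq_zero {h : cube n → ℂ} (hi : Integrable h)
    (hz : ∀ k, ∫ t, phase k t * h t = 0) (φ : C(UnitAddTorus (Fin n), ℂ)) :
    ∫ t, φ (toTorus t) * h t = 0 := by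
  have hint (φ : C(UnitAddTorus (Fin n), ℂ)) : Integrable fun t => φ (toTorus t) * h t :=
    hi.bdd_mul (φ.continuous.comp continuous_toTorus).aestronglyMeasurable
      (Filter.Eventually.of_forall fun t => φ.norm_coe_le_norm _)
  let Λ : C(UnitAddTorus (Fin n), ℂ) →L[ℂ] ℂ := LinearMap.mkContinuous
    { toFun := fun φ => ∫ t, φ (toTorus t) * h t
      map_add' := fun φ ψ => by
        rw [← integral_add (hint φ) (hint ψ)]
        simp [add_mul]
      map_smul' := fun c φ => by
        simp only [ContinuousMap.smul_apply, smul_eq_mul, RingHom.id_apply, mul_assoc]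
        rw [integral_const_mul] } (∫ t, ‖h t‖) fun φ => by
      change ‖∫ t, φ (toTorus t) * h t‖ ≤ _
      rw [mul_comm, ← integral_const_mul]
      refine norm_integral_le_of_norm_le (hi.norm.const_mul _) (Filter.Eventually.of_forall ?_)
      intro t
      rw [norm_mul]
      exact mul_le_mul_of_nonneg_right (φ.norm_coe_le_norm _) (norm_nonneg _)
  have hΛ : Λ = 0 := by
    refine ContinuousLinearMap.ext_on
      (s := Set.range (UnitAddTorus.mFourier (d := Fin n))) ?_ ?_
    · rw [Submodule.dense_iff_topologicalClosure_eq_top]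
      exact UnitAddTorus.span_mFourier_closure_eq_top
    · rintro _ ⟨k, rfl⟩
      change ∫ t, UnitAddTorus.mFourier k (toTorus t) * h t = 0
      simp only [mFourier_toTorus]
      exact hz (-k)
  exact DFunLike.congr_fun hΛ φ

/-- The positive and negative parts of `g` are densities of two finite measures. Pushed forward to
the torus, these give equal integrals to all continuous functions, hence coincide. -/
theorem ae_eq_zero_of_integral_comp_toTorus_mul {g : cube n → ℝ} (hi : Integrable g)
    (hz : ∀ φ : C(UnitAddTorus (Fin n), ℝ), ∫ t, φ (toTorus t) * g t = 0) :
    g =ᵐ[volume] 0 := by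
  have hm := (continuous_toTorus (n := n)).measurable
  let ν (g : cube n → ℝ) : Measure (UnitAddTorus (Fin n)) :=
    (volume.withDensity fun t => ENNReal.ofReal (g t)).map toTorus
  have hfin (g : cube n → ℝ) (hi : Integrable g) :
      IsFiniteMeasure (volume.withDensity fun t => ENNReal.ofReal (g t)) :=
    isFiniteMeasure_withDensity_ofReal hi.2
  have hν (g : cube n → ℝ) (hi : Integrable g) (φ : C(UnitAddTorus (Fin n), ℝ)) :
      ∫ x, φ x ∂ν g = ∫ t, φ (toTorus t) * max (g t) 0 := by
    rw [integral_map hm.aemeasurable φ.continuous.aestronglyMeasurable,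
      integral_withDensity_eq_integral_toReal_smul₀ hi.1.aemeasurable.ennreal_ofReal
        (Filter.Eventually.of_forall fun t => ENNReal.ofReal_lt_top)]
    refine integral_congr_ae (Filter.Eventually.of_forall fun t => ?_)
    simp [ENNReal.toReal_ofReal', mul_comm]
  have hbd (φ : C(UnitAddTorus (Fin n), ℝ)) (g : cube n → ℝ) (hi : Integrable g) :
      Integrable fun t => φ (toTorus t) * max (g t) 0 :=
    hi.pos_part.bdd_mul (f := fun t => φ (toTorus t)) (c := ‖φ‖)
      (φ.continuous.comp continuous_toTorus).aestronglyMeasurable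
      (Filter.Eventually.of_forall fun t => φ.norm_coe_le_norm _)
  have heq : ν g = ν (-g) := by
    have := hfin g hi
    have := hfin (-g) hi.neg
    have : IsFiniteMeasure (ν g) := Measure.isFiniteMeasure_map _ _
    have : IsFiniteMeasure (ν (-g)) := Measure.isFiniteMeasure_map _ _
    refine ext_of_forall_integral_eq_of_IsFiniteMeasure fun φ => ?_
    have h1 := hν g hi φ.toContinuousMap
    have h2 := hν (-g) hi.neg φ.toContinuousMap
    have h3 := hz φ.toContinuousMap
    refine h1.trans (Eq.trans ?_ h2.symm)
    rw [← sub_eq_zero, ← integral_sub (hbd _ _ hi) (hbd _ _ hi.neg)]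
    refine Eq.trans ?_ h3
    refine integral_congr_ae (Filter.Eventually.of_forall fun t => ?_)
    simp only [← mul_sub, Pi.neg_apply]
    congr 1
    rcases le_total (g t) 0 with h | h
    · rw [max_eq_right h, max_eq_left (by linarith)]; ring
    · rw [max_eq_left h, max_eq_right (by linarith)]; ring
  refine hi.ae_eq_zero_of_forall_setIntegral_eq_zero fun E hE _ => ?_
  obtain ⟨B, hB, rfl⟩ := exists_preimage_toTorus hE
  have h := congrArg (fun m => (m B).toReal) heq
  simp only [ν] at h
  rw [Measure.map_apply hm hB, Measure.map_apply hm hB, withDensity_apply _ hE,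
    withDensity_apply _ hE] at h
  rw [integral_eq_lintegral_pos_part_sub_lintegral_neg_part hi.integrableOn, h]
  simp

theorem ae_eq_zero_of_integral_phase_mul {h : cube n → ℂ} (hi : Integrable h)
    (hz : ∀ k, ∫ t, phase k t * h t = 0) : h =ᵐ[volume] 0 := by
  have key (φ : C(UnitAddTorus (Fin n), ℝ)) : ∫ t, ((φ (toTorus t) : ℝ) : ℂ) * h t = 0 :=
    integral_comp_toTorus_mul_eq_zero hi hz
      ⟨fun x => (φ x : ℂ), Complex.continuous_ofReal.comp φ.continuous⟩
  have hint (φ : C(UnitAddTorus (Fin n), ℝ)) :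
      Integrable fun t => ((φ (toTorus t) : ℝ) : ℂ) * h t :=
    hi.bdd_mul (c := ‖φ‖) (Complex.continuous_ofReal.comp
      (φ.continuous.comp continuous_toTorus)).aestronglyMeasurable
      (Filter.Eventually.of_forall fun t => by
        rw [Complex.norm_real]; exact φ.norm_coe_le_norm _)
  have hre : (fun t => (h t).re) =ᵐ[volume] 0 := by
    refine ae_eq_zero_of_integral_comp_toTorus_mul hi.re fun φ => ?_
    have := congrArg Complex.re (key φ)
    rw [← RCLike.re_eq_complex_re, ← integral_re (hint φ)] at this
    simpa using this
  have him : (fun t => (h t).im) =ᵐ[volume] 0 := by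
    refine ae_eq_zero_of_integral_comp_toTorus_mul hi.im fun φ => ?_
    have := congrArg Complex.im (key φ)
    rw [← RCLike.im_eq_complex_im, ← integral_im (hint φ)] at this
    simpa using this
  filter_upwards [hre, him] with t h1 h2
  exact Complex.ext h1 h2

end ShiftInv

namespace ShiftInv

variable {n : ℕ} {s : ℝ}

/-! ### Pointwise consequences of shift-invariance -/

theorem fiber_sub (f g : Sobolev n s) :
    ∀ᵐ t : cube n, fiber (f - g) t = fiber f t - fiber g t := by
  filter_upwards [fiber_add (f - g) g] with t ht
  rw [sub_add_cancel] at ht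
  rw [ht, add_sub_cancel_right]

theorem fiber_sum {ι : Type*} (S : Finset ι) (c : ι → ℂ) (v : ι → Sobolev n s) :
    ∀ᵐ t : cube n, fiber (∑ i ∈ S, c i • v i) t = ∑ i ∈ S, c i • fiber (v i) t := by
  classical
  induction S using Finset.induction_on with
  | empty =>
    filter_upwards [fiber_smul 0 (0 : Sobolev n s)] with t ht
    simpa using ht
  | insert i S hi ih =>
    rw [Finset.sum_insert hi]
    filter_upwards [ih, fiber_add (c i • v i) (∑ i ∈ S, c i • v i), fiber_smul (c i) (v i)]
      with t h1 h2 h3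
    rw [h2, h1, h3, Finset.sum_insert hi]

theorem norm_le_of_fiber_le {f g : Sobolev n s} {C : ℝ}
    (h : ∀ᵐ t : cube n, ‖fiber f t‖ ≤ C * ‖fiber g t‖) : ‖f‖ ≤ C * ‖g‖ := by
  rw [← fiberIsometry.norm_map f, ← fiberIsometry.norm_map g]
  refine Lp.norm_le_mul_norm_of_ae_le_mul ?_
  filter_upwards [h, coeFn_fiberIsometry f, coeFn_fiberIsometry g] with t h1 h2 h3
  rwa [h2, h3]

theorem exists_fiber_eq_const (a : SeqSpace n s) :
    ∃ f : Sobolev n s, ∀ᵐ t : cube n, fiber f t = a :=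
  exists_fiber_ae_eq (memLp_const a)

theorem integral_phase_mul_inner_fiber (k : Zn n) (h f : Sobolev n s) :
    ∫ t : cube n, phase k t * inner ℂ (fiber h t) (fiber f t) = inner ℂ h (f.shift k) := by
  rw [inner_eq_integral_inner_fiber]
  refine integral_congr_ae ?_
  filter_upwards [fiber_shift k f] with t ht
  rw [ht, inner_smul_right]

/-- The Fourier coefficients of this function are the products `⟨h, T_k f⟩`, which vanish as `T_k f
∈ V`. -/
theorem inner_fiber_ae_eq_zero {V : Submodule ℂ (Sobolev n s)} (hV : IsShiftInvariant V)
    {f h : Sobolev n s} (hf : f ∈ V) (hh : h ∈ Vᗮ) :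
    ∀ᵐ t : cube n, inner ℂ (fiber h t) (fiber f t) = 0 := by
  refine ae_eq_zero_of_integral_phase_mul (integrable_inner_fiber h f) fun k => ?_
  rw [integral_phase_mul_inner_fiber]
  exact V.inner_left_of_mem_orthogonal (hV f hf k) hh

/-! ### Existence of the range function -/

theorem ae_fiber_mem_of_mem_closure {J : RangeFunction n s} {S : Set (Sobolev n s)}
    (hS : ∀ g ∈ S, ∀ᵐ t, fiber g t ∈ J t) {f : Sobolev n s} (hf : f ∈ closure S) :
    ∀ᵐ t, fiber f t ∈ J t := by
  obtain ⟨x, hxS, hx⟩ := mem_closure_iff_seq_limit.1 hf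
  have h1 := tendstoInMeasure_of_tendsto_Lp
    ((fiberIsometry.continuous.tendsto f).comp hx)
  -- Convergence in norm gives almost everywhere convergence of the fibers along a subsequence, and
  -- each `J t` is closed.
  obtain ⟨ns, -, hns⟩ := h1.exists_seq_tendsto_ae
  have h2 : ∀ᵐ t, ∀ i, fiber (x i) t ∈ J t := ae_all_iff.2 fun i => hS _ (hxS i)
  have h3 : ∀ᵐ t, ∀ i, fiberIsometry (x i) t = fiber (x i) t :=
    ae_all_iff.2 fun i => coeFn_fiberIsometry _
  filter_upwards [hns, h2, h3, coeFn_fiberIsometry f] with t h4 h5 h6 h7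
  rw [h7] at h4
  refine (J t).isClosed.mem_of_tendsto h4 (Filter.Eventually.of_forall fun i => ?_)
  simp only [Function.comp_apply, h6]
  exact h5 _

theorem mem_orthogonal_closure_span {S : Set (SeqSpace n s)} {x : SeqSpace n s}
    (h : ∀ y ∈ S, inner ℂ x y = 0) : x ∈ (Submodule.span ℂ S).topologicalClosureᗮ := by
  rw [Submodule.orthogonal_closure, Submodule.mem_orthogonal']
  intro u hu
  induction hu using Submodule.span_induction with
  | mem y hy => exact h y hy
  | zero => exact inner_zero_right _
  | add y z _ _ hy hz => rw [inner_add_right, hy, hz, add_zero]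
  | smul c y _ hy => rw [inner_smul_right, hy, mul_zero]

theorem exists_isRangeFunctionOf {V : Submodule ℂ (Sobolev n s)}
    (hVc : IsClosed (V : Set (Sobolev n s))) (hV : IsShiftInvariant V) :
    ∃ J : RangeFunction n s, IsRangeFunctionOf J V := by
  have : CompleteSpace V := hVc.completeSpace_coe
  let v (i : ℕ) : Sobolev n s := (TopologicalSpace.denseSeq V i : V)
  have hvV (i) : v i ∈ V := (TopologicalSpace.denseSeq V i).2
  let K (t : cube n) : Submodule ℂ (SeqSpace n s) :=
    (Submodule.span ℂ (Set.range fun i => fiber (v i) t)).topologicalClosure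
  let J : RangeFunction n s := fun t => ⟨K t, Submodule.isClosed_topologicalClosure _⟩
  have hJ : ∀ f ∈ V, ∀ᵐ t, fiber f t ∈ J t := by
    intro f hf
    refine ae_fiber_mem_of_mem_closure (S := Set.range v) ?_ ?_
    · rintro _ ⟨i, rfl⟩
      refine Filter.Eventually.of_forall fun t => ?_
      exact Submodule.le_topologicalClosure _ (Submodule.subset_span ⟨i, rfl⟩)
    · have h := image_closure_subset_closure_image (continuous_subtype_val (p := (· ∈ V)))
        (s := Set.range (TopologicalSpace.denseSeq V))
      rw [(TopologicalSpace.denseRange_denseSeq V).closure_range, ← Set.range_comp] at h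
      exact h ⟨⟨f, hf⟩, trivial, rfl⟩
  have horth : ∀ h ∈ Vᗮ, ∀ᵐ t, fiber h t ∈ (K t)ᗮ := by
    intro h hh
    have h1 : ∀ᵐ t, ∀ i, inner ℂ (fiber h t) (fiber (v i) t) = 0 :=
      ae_all_iff.2 fun i => inner_fiber_ae_eq_zero hV (hvV i) hh
    filter_upwards [h1] with t ht
    refine mem_orthogonal_closure_span ?_
    rintro _ ⟨i, rfl⟩
    exact ht i
  refine ⟨J, ?_, fun f => ⟨hJ f, fun hf => ?_⟩⟩
  · intro a b
    obtain ⟨c, hc⟩ := exists_fiber_eq_const a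
    -- The fibers of `g` and `c - g` split the constant `a` into a part in `K t` and a part
    -- orthogonal to it, so the fiber of `g` is the projection of `a`.
    let g := V.starProjection c
    have hm := (aestronglyMeasurable_const (b := b)).inner (𝕜 := ℂ) (aestronglyMeasurable_fiber g)
    refine hm.aemeasurable.congr ?_
    filter_upwards [hc, hJ g (V.starProjection_apply_mem c),
      horth (c - g) (V.sub_starProjection_mem_orthogonal c), fiber_sub c g] with t h1 h2 h3 h4
    rw [h4, h1] at h3
    congr 1
    exact (Submodule.eq_starProjection_of_mem_orthogonal h2 h3).symm
  -- As `V` is closed, it suffices to test against `Vᗮ`, whose fibers are orthogonal to `K t`.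
  · rw [← V.orthogonal_orthogonal, Submodule.mem_orthogonal]
    intro h hh
    rw [inner_eq_integral_inner_fiber]
    refine integral_eq_zero_of_ae ?_
    filter_upwards [hf, horth h hh] with t h1 h2
    exact (K t).inner_left_of_mem_orthogonal h1 h2

/-! ### The projections of a dense sequence -/

variable {V : Submodule ℂ (Sobolev n s)} {J : RangeFunction n s}

/-- The projections to `K` of a fixed dense sequence of `ℓ²_s`. -/
def projSeq (K : ClosedSubmodule ℂ (SeqSpace n s)) (i : ℕ) : K.toSubmodule :=
  K.toSubmodule.orthogonalProjectionOnto (TopologicalSpace.denseSeq (SeqSpace n s) i)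

theorem denseRange_projSeq (K : ClosedSubmodule ℂ (SeqSpace n s)) : DenseRange (projSeq K) := by
  have h : Function.Surjective K.toSubmodule.orthogonalProjectionOnto := fun x =>
    ⟨x, Submodule.orthogonalProjectionOnto_mem_subspace_eq_self x⟩
  exact h.denseRange.comp (TopologicalSpace.denseRange_denseSeq _)
    (ContinuousLinearMap.continuous _)

/-- The projections of `a` are measurable in `t` and bounded by `‖a‖` on a set of finite measure,
hence square-integrable. -/
theorem IsRangeFunctionOf.exists_fiber_eq_proj (hJ : IsRangeFunctionOf J V) (a : SeqSpace n s) :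
    ∃ f : V, ∀ᵐ t, fiber (f : Sobolev n s) t = (J t).toSubmodule.orthogonalProjectionOnto a := by
  have hm : AEStronglyMeasurable (fun t => (J t).toSubmodule.starProjection a)
      (volume : Measure (cube n)) := aestronglyMeasurable_of_inner fun b => hJ.measurable a b
  obtain ⟨f, hf⟩ := exists_fiber_ae_eq (MemLp.of_bound hm ‖a‖ (Filter.Eventually.of_forall
    fun t => Submodule.norm_starProjection_apply_le _ a))
  refine ⟨⟨f, (hJ.mem_iff f).2 ?_⟩, hf⟩
  filter_upwards [hf] with t ht
  rw [ht]
  exact Submodule.starProjection_apply_mem _ a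

theorem IsRangeFunctionOf.exists_fiber_eq_projSeq (hJ : IsRangeFunctionOf J V) :
    ∃ p : ℕ → V, ∀ᵐ t, ∀ i, fiber (p i : Sobolev n s) t = projSeq (J t) i := by
  choose p hp using fun i => hJ.exists_fiber_eq_proj (TopologicalSpace.denseSeq (SeqSpace n s) i)
  exact ⟨p, ae_all_iff.2 hp⟩

/-! ### Localization to measurable subsets of the cube -/

theorem IsRangeFunctionOf.exists_fiber_eq_indicator (hJ : IsRangeFunctionOf J V)
    {E : Set (cube n)} (hE : MeasurableSet E) (f : V) :
    ∃ g : V, ∀ᵐ t, fiber (g : Sobolev n s) t = E.indicator (fiber (f : Sobolev n s)) t := by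
  obtain ⟨g, hg⟩ := exists_fiber_ae_eq ((memLp_fiber (f : Sobolev n s)).indicator hE)
  refine ⟨⟨g, (hJ.mem_iff g).2 ?_⟩, hg⟩
  filter_upwards [hg, (hJ.mem_iff f).1 f.2] with t h1 h2
  rw [h1]
  by_cases ht : t ∈ E
  · rwa [Set.indicator_of_mem ht]
  · rw [Set.indicator_of_notMem ht]
    exact (J t).toSubmodule.zero_mem

theorem lintegral_indicator_fiber {E : Set (cube n)} (hE : MeasurableSet E) {f g : Sobolev n s}
    (h : ∀ᵐ t, fiber g t = E.indicator (fiber f) t) :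
    ∫⁻ t in E, ‖fiber f t‖ₑ ^ 2 = ‖g‖ₑ ^ 2 := by
  rw [← lintegral_enorm_fiber_sq, ← lintegral_indicator hE]
  refine lintegral_congr_ae ?_
  filter_upwards [h] with t ht
  rw [ht]
  by_cases htE : t ∈ E <;> simp [htE]

/-- The operator `L` commutes, on the side of the fibers, with the multiplication by the indicator
functions of measurable sets. -/
def CommutesWithIndicators (L : V →L[ℂ] Sobolev n s) : Prop :=
  ∀ E : Set (cube n), MeasurableSet E → ∀ f g : V,
    (∀ᵐ t, fiber (g : Sobolev n s) t = E.indicator (fiber (f : Sobolev n s)) t) →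
      ∀ᵐ t, fiber (L g) t = E.indicator (fiber (L f)) t

/-- The global bound, applied to `f` with its fibers cut off to `E`, compares the integrals over
every measurable `E`. -/
theorem CommutesWithIndicators.norm_fiber_le {L : V →L[ℂ] Sobolev n s}
    (hL : CommutesWithIndicators L) (hJ : IsRangeFunctionOf J V) {C : ℝ} (hC : 0 ≤ C)
    (hLC : ∀ f, ‖L f‖ ≤ C * ‖f‖) (f : V) :
    ∀ᵐ t, ‖fiber (L f) t‖ ≤ C * ‖fiber (f : Sobolev n s) t‖ := by
  have key : (fun t : cube n => ‖fiber (L f) t‖ₑ ^ 2) ≤ᵐ[volume]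
      fun t => ENNReal.ofReal C ^ 2 * ‖fiber (f : Sobolev n s) t‖ₑ ^ 2 := by
    refine ae_le_of_forall_setLIntegral_le_of_sigmaFinite₀
      ((aestronglyMeasurable_fiber _).enorm.pow_const 2) fun E hE _ => ?_
    obtain ⟨g, hg⟩ := hJ.exists_fiber_eq_indicator hE f
    rw [lintegral_const_mul'' _
      ((aestronglyMeasurable_fiber _).enorm.pow_const 2).restrict, lintegral_indicator_fiber hE hg,
      lintegral_indicator_fiber hE (hL E hE f g hg), ← mul_pow]
    gcongr
    rw [← ofReal_norm, ← ofReal_norm, ← ENNReal.ofReal_mul hC]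
    exact ENNReal.ofReal_le_ofReal (hLC g)
  filter_upwards [key] with t ht
  rw [← ofReal_norm, ← ofReal_norm, ← ENNReal.ofReal_pow hC, ← ENNReal.ofReal_pow (norm_nonneg _),
    ← ENNReal.ofReal_pow (norm_nonneg _), ← ENNReal.ofReal_mul (by positivity),
    ENNReal.ofReal_le_ofReal_iff (by positivity), ← mul_pow] at ht
  exact le_of_sq_le_sq ht (by positivity)

theorem CommutesWithIndicators.norm_fiber_eq {L : V →L[ℂ] Sobolev n s}
    (hL : CommutesWithIndicators L) (hJ : IsRangeFunctionOf J V) (hLi : Isometry L) (f : V) :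
    ∀ᵐ t, ‖fiber (L f) t‖ = ‖fiber (f : Sobolev n s) t‖ := by
  have key : (fun t : cube n => ‖fiber (L f) t‖ₑ ^ 2) =ᵐ[volume]
      fun t => ‖fiber (f : Sobolev n s) t‖ₑ ^ 2 := by
    refine ae_eq_of_forall_setLIntegral_eq_of_sigmaFinite₀
      ((aestronglyMeasurable_fiber _).enorm.pow_const 2)
      ((aestronglyMeasurable_fiber _).enorm.pow_const 2) fun E hE _ => ?_
    obtain ⟨g, hg⟩ := hJ.exists_fiber_eq_indicator hE f
    rw [lintegral_indicator_fiber hE hg, lintegral_indicator_fiber hE (hL E hE f g hg)]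
    have := (AddMonoidHomClass.isometry_iff_norm L).1 hLi g
    rw [← ofReal_norm, ← ofReal_norm, this]
    rfl
  filter_upwards [key] with t ht
  have h := (ENNReal.pow_right_strictMono two_ne_zero).injective ht
  simpa using congrArg ENNReal.toReal h

end ShiftInv

namespace ShiftInv

variable {n : ℕ} {s : ℝ} {V : Submodule ℂ (Sobolev n s)} {J : RangeFunction n s}

/-! ### The range operator of a shift-preserving operator -/

theorem IsShiftPreserving.exists_fiber_adjoint (hVc : IsClosed (V : Set (Sobolev n s)))
    {hV : IsShiftInvariant V} {L : V →L[ℂ] Sobolev n s} (hL : IsShiftPreserving hV L)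
    (h : Sobolev n s) : ∃ u : Sobolev n s, ∀ f : V, ∀ᵐ t : cube n,
      inner ℂ (fiber h t) (fiber (L f) t) = inner ℂ (fiber u t) (fiber (f : Sobolev n s) t) := by
  have : CompleteSpace V := hVc.completeSpace_coe
  -- `L` is extended by zero on `Vᗮ` so that the adjoint acts on all of `H^s`.
  let M : Sobolev n s →L[ℂ] Sobolev n s := L ∘L V.orthogonalProjectionOnto
  have hM (f : V) : M f = L f := by
    simp [M, Submodule.orthogonalProjectionOnto_mem_subspace_eq_self]
  refine ⟨ContinuousLinearMap.adjoint M h, fun f => ?_⟩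
  set u := ContinuousLinearMap.adjoint M h
  have h1 := integrable_inner_fiber h (L f)
  have h2 := integrable_inner_fiber u (f : Sobolev n s)
  have h3 (k : Zn n) {F : cube n → ℂ} (hF : Integrable F) : Integrable fun t => phase k t * F t := by
    refine hF.bdd_mul (c := 1) ?_ (Filter.Eventually.of_forall fun t => (norm_phase k t).le)
    exact ((phase_hasTemperateGrowth (latticePt k)).1.continuous.comp
      continuous_subtype_val).aestronglyMeasurable
  -- The `k`-th coefficient of the difference is `⟨h, T_k L f⟩ - ⟨h, M T_k f⟩`, which is zero
  -- because `L` commutes with `T_k`.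
  have key := ae_eq_zero_of_integral_phase_mul (h1.sub h2) fun k => by
    simp only [Pi.sub_apply, mul_sub]
    rw [integral_sub (h3 k h1) (h3 k h2), integral_phase_mul_inner_fiber,
      integral_phase_mul_inner_fiber, ContinuousLinearMap.adjoint_inner_left, ← hL k f, ← hM,
      sub_self]
  filter_upwards [key] with t ht
  exact sub_eq_zero.1 ht

/-- A dense sequence of constant fibers serves as test vectors, so the value of `L f` at `t` is
determined by that of `f` at `t`. -/
theorem IsShiftPreserving.exists_pointwise_adjoint (hVc : IsClosed (V : Set (Sobolev n s)))
    {hV : IsShiftInvariant V} {L : V →L[ℂ] Sobolev n s} (hL : IsShiftPreserving hV L) :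
    ∃ u : ℕ → cube n → SeqSpace n s, ∀ f : V, ∀ᵐ t : cube n, ∀ i,
      inner ℂ (TopologicalSpace.denseSeq (SeqSpace n s) i) (fiber (L f) t) =
        inner ℂ (u i t) (fiber (f : Sobolev n s) t) := by
  choose c hc using fun i =>
    exists_fiber_eq_const (n := n) (TopologicalSpace.denseSeq (SeqSpace n s) i)
  choose u hu using fun i => hL.exists_fiber_adjoint hVc (c i)
  refine ⟨fun i => fiber (u i), fun f => ae_all_iff.2 fun i => ?_⟩
  filter_upwards [hc i, hu i f] with t h1 h2
  rw [← h2, h1]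

theorem eq_of_inner_denseSeq {x y : SeqSpace n s}
    (h : ∀ i, inner ℂ (TopologicalSpace.denseSeq (SeqSpace n s) i) x =
      inner ℂ (TopologicalSpace.denseSeq (SeqSpace n s) i) y) : x = y := by
  refine Dense.eq_of_inner_right ℂ (TopologicalSpace.denseRange_denseSeq (SeqSpace n s)) ?_
  rintro _ ⟨i, rfl⟩
  exact h i

theorem IsShiftPreserving.commutesWithIndicators (hVc : IsClosed (V : Set (Sobolev n s)))
    {hV : IsShiftInvariant V} {L : V →L[ℂ] Sobolev n s} (hL : IsShiftPreserving hV L) :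
    CommutesWithIndicators L := by
  obtain ⟨u, hu⟩ := hL.exists_pointwise_adjoint hVc
  intro E hE f g hg
  filter_upwards [hg, hu f, hu g] with t h1 h2 h3
  refine eq_of_inner_denseSeq fun i => ?_
  rw [h3, h1]
  by_cases ht : t ∈ E
  · rw [Set.indicator_of_mem ht, Set.indicator_of_mem ht, h2]
  · rw [Set.indicator_of_notMem ht, Set.indicator_of_notMem ht, inner_zero_right, inner_zero_right]

/-- The point is one null set for all coefficients: the bound is taken for countably many dense
coefficient vectors on each finite set, then extended by continuity. -/
theorem IsShiftPreserving.norm_sum_le (hVc : IsClosed (V : Set (Sobolev n s)))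
    {hV : IsShiftInvariant V} {L : V →L[ℂ] Sobolev n s} (hL : IsShiftPreserving hV L)
    (hJ : IsRangeFunctionOf J V) (p : ℕ → V) : ∀ᵐ t : cube n, ∀ c : ℕ →₀ ℂ,
      ‖Finsupp.linearCombination ℂ (fun i => fiber (L (p i)) t) c‖ ≤
        ‖L‖ * ‖Finsupp.linearCombination ℂ (fun i => fiber (p i : Sobolev n s) t) c‖ := by
  have h : ∀ᵐ t : cube n, ∀ (S : Finset ℕ) (j : ℕ),
      ‖∑ i : S, TopologicalSpace.denseSeq (S → ℂ) j i • fiber (L (p i)) t‖ ≤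
      ‖L‖ * ‖∑ i : S, TopologicalSpace.denseSeq (S → ℂ) j i • fiber (p i : Sobolev n s) t‖ := by
    refine ae_all_iff.2 fun S => ae_all_iff.2 fun j => ?_
    set c := TopologicalSpace.denseSeq (S → ℂ) j
    filter_upwards [(hL.commutesWithIndicators hVc).norm_fiber_le hJ (norm_nonneg L)
      L.le_opNorm (∑ i : S, c i • p i), fiber_sum Finset.univ c fun i : S => L (p i),
      fiber_sum Finset.univ c fun i : S => (p i : Sobolev n s)] with t h1 h2 h3
    rw [← h2, ← h3]
    simpa using h1
  filter_upwards [h] with t ht c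
  have hS := (TopologicalSpace.denseRange_denseSeq (c.support → ℂ)).induction_on
    (p := fun d => ‖∑ i : c.support, d i • fiber (L (p i)) t‖ ≤
      ‖L‖ * ‖∑ i : c.support, d i • fiber (p i : Sobolev n s) t‖) (fun i => c i)
    (isClosed_le (by fun_prop) (by fun_prop)) (ht c.support)
  rw [Finsupp.linearCombination_apply, Finsupp.linearCombination_apply, Finsupp.sum, Finsupp.sum,
    ← Finset.sum_coe_sort c.support fun i => c i • fiber (L (p i)) t,
    ← Finset.sum_coe_sort c.support fun i => c i • fiber (p i : Sobolev n s) t]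
  exact hS

theorem denseRange_linearCombination_projSeq (K : ClosedSubmodule ℂ (SeqSpace n s)) :
    DenseRange (Finsupp.linearCombination ℂ (projSeq K)) := by
  refine (denseRange_projSeq K).mono ?_
  rintro _ ⟨i, rfl⟩
  exact ⟨Finsupp.single i 1, by simp⟩

theorem IsShiftPreserving.exists_rangeOperator (hVc : IsClosed (V : Set (Sobolev n s)))
    {hV : IsShiftInvariant V} {L : V →L[ℂ] Sobolev n s} (hL : IsShiftPreserving hV L)
    (hJ : IsRangeFunctionOf J V) : ∃ R : cube n → PartialOp n s, IsRangeOperatorOn J R ∧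
      IsMeasurableRangeOperator R ∧ Corresponds L R := by
  obtain ⟨p, hp⟩ := hJ.exists_fiber_eq_projSeq
  obtain ⟨u, hu⟩ := hL.exists_pointwise_adjoint hVc
  let e (t : cube n) := Finsupp.linearCombination ℂ (projSeq (J t))
  let g (t : cube n) := Finsupp.linearCombination ℂ (fun i => fiber (L (p i)) t)
  -- The vectors `projSeq (J t) i` may be linearly dependent, so the operator is prescribed on
  -- formal combinations; `norm_sum_le` makes it descend to their span and extend to `J t`. Its
  -- values on the exceptional null set do not matter.
  let A (t : cube n) : (J t).toSubmodule →L[ℂ] SeqSpace n s := (g t).extendOfNorm (e t)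
  have hA : ∀ᵐ t, ∀ i, A t (projSeq (J t) i) = fiber (L (p i)) t := by
    filter_upwards [hL.norm_sum_le hVc hJ p, hp] with t h1 h2 i
    have h3 := LinearMap.extendOfNorm_eq (f := g t) (e := e t)
      (denseRange_linearCombination_projSeq (J t)) ⟨‖L‖, fun c => ?_⟩ (Finsupp.single i 1)
    · simpa [e, g] using h3
    · refine (h1 c).trans (le_of_eq ?_)
      rw [← Submodule.norm_coe (e t c)]
      congr 2
      simp only [e, Finsupp.linearCombination_apply, Finsupp.sum, h2]
      simp
  have hC : ∀ f : V, ∀ᵐ t, ∃ h : fiber (f : Sobolev n s) t ∈ J t,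
      fiber (L f) t = A t ⟨fiber (f : Sobolev n s) t, h⟩ := by
    intro f
    have hup : ∀ᵐ t, ∀ j i, inner ℂ (TopologicalSpace.denseSeq (SeqSpace n s) i)
        (fiber (L (p j)) t) = inner ℂ (u i t) (fiber (p j : Sobolev n s) t) :=
      ae_all_iff.2 fun j => hu (p j)
    filter_upwards [hA, hp, hu f, hup, (hJ.mem_iff f).1 f.2] with t h1 h2 h3 h4 h5
    refine ⟨h5, eq_of_inner_denseSeq fun i => ?_⟩
    rw [h3]
    -- Both sides are continuous in `x ∈ J t` and agree on the dense sequence, so the exceptional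
    -- set for `f` needs no approximation of `f` itself.
    have h6 := (denseRange_projSeq (J t)).equalizer
      (g := fun x => inner ℂ (u i t) (x : SeqSpace n s))
      (h := fun x => inner ℂ (TopologicalSpace.denseSeq (SeqSpace n s) i) (A t x))
      (by fun_prop) (by fun_prop) (funext fun j => by
        simp only [Function.comp_apply]
        rw [h1, h4, h2])
    exact congrFun h6 ⟨_, h5⟩
  refine ⟨fun t => ⟨J t, A t⟩, Filter.Eventually.of_forall fun t => rfl, fun a b => ?_, hC⟩
  -- With `f` having the projections of `a` as fibers, `R(t) P(t) a` is the fiber of `L f`, which is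
  -- measurable.
  obtain ⟨f, hf⟩ := hJ.exists_fiber_eq_proj a
  have hm := (aestronglyMeasurable_const (b := b)).inner (𝕜 := ℂ)
    (aestronglyMeasurable_fiber (L f))
  refine hm.aemeasurable.congr ?_
  filter_upwards [hC f, hf] with t ⟨h1, h2⟩ h3
  rw [h2]
  congr 2
  exact Subtype.ext h3

/-! ### Range operators are determined by their values on fibers -/

theorem Corresponds.ae_op_projSeq {L : V →L[ℂ] Sobolev n s} {R : cube n → PartialOp n s}
    (hR : IsRangeOperatorOn J R) (hLR : Corresponds L R) {p : ℕ → V}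
    (hp : ∀ᵐ t, ∀ i, fiber (p i : Sobolev n s) t = projSeq (J t) i) :
    ∀ᵐ t, ∀ i, (R t).op (projSeq (R t).dom i) = fiber (L (p i)) t := by
  have h : ∀ᵐ t, ∀ i, ∃ h : fiber (p i : Sobolev n s) t ∈ (R t).dom,
    fiber (L (p i)) t = (R t).op ⟨fiber (p i : Sobolev n s) t, h⟩ := ae_all_iff.2 fun i => hLR (p i)
  filter_upwards [hR, hp, h] with t h1 h2 h3 i
  obtain ⟨h4, h5⟩ := h3 i
  rw [h5]
  congr 1
  refine Subtype.ext ?_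
  change _ = fiber (p i : Sobolev n s) t
  rw [h2, h1]

theorem PartialOp.ext_of_projSeq {A B : PartialOp n s} (hd : A.dom = B.dom)
    (h : ∀ i, A.op (projSeq A.dom i) = B.op (projSeq B.dom i)) : A = B := by
  obtain ⟨K, A⟩ := A
  obtain ⟨K', B⟩ := B
  obtain rfl : K = K' := hd
  congr 1
  exact DFunLike.coe_injective
    ((denseRange_projSeq K).equalizer A.continuous B.continuous (funext h))

theorem Corresponds.ae_eq {L : V →L[ℂ] Sobolev n s} {R R' : cube n → PartialOp n s}
    (hJ : IsRangeFunctionOf J V) (hR : IsRangeOperatorOn J R) (hR' : IsRangeOperatorOn J R')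
    (hLR : Corresponds L R) (hLR' : Corresponds L R') : ∀ᵐ t, R' t = R t := by
  obtain ⟨p, hp⟩ := hJ.exists_fiber_eq_projSeq
  filter_upwards [hR, hR', hLR.ae_op_projSeq hR hp, hLR'.ae_op_projSeq hR' hp] with t h1 h2 h3 h4
  refine PartialOp.ext_of_projSeq (h2.trans h1.symm) fun i => ?_
  rw [h3, h4]

theorem Corresponds.commutesWithIndicators {L : V →L[ℂ] Sobolev n s} {R : cube n → PartialOp n s}
    (hLR : Corresponds L R) : CommutesWithIndicators L := by
  intro E hE f g hg
  filter_upwards [hg, hLR f, hLR g] with t h1 ⟨h2, h3⟩ ⟨h4, h5⟩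
  rw [h5]
  by_cases ht : t ∈ E
  · rw [Set.indicator_of_mem ht] at h1 ⊢
    rw [h3]
    congr 1
    exact Subtype.ext h1
  · rw [Set.indicator_of_notMem ht] at h1 ⊢
    rw [← map_zero (R t).op]
    congr 1
    exact Subtype.ext h1

theorem Corresponds.isometry_iff {L : V →L[ℂ] Sobolev n s} {R : cube n → PartialOp n s}
    (hJ : IsRangeFunctionOf J V) (hR : IsRangeOperatorOn J R) (hLR : Corresponds L R) :
    Isometry L ↔ ∀ᵐ t, Isometry (R t).op := by
  constructor
  · intro hL
    obtain ⟨p, hp⟩ := hJ.exists_fiber_eq_projSeq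
    have h : ∀ᵐ t, ∀ i, ‖fiber (L (p i)) t‖ = ‖fiber (p i : Sobolev n s) t‖ :=
      ae_all_iff.2 fun i => hLR.commutesWithIndicators.norm_fiber_eq hJ hL (p i)
    filter_upwards [hR, hp, h, hLR.ae_op_projSeq hR hp] with t h1 h2 h3 h4
    refine (AddMonoidHomClass.isometry_iff_norm _).2 fun x => ?_
    refine (denseRange_projSeq (R t).dom).induction_on
      (p := fun x => ‖(R t).op x‖ = ‖x‖) x (isClosed_eq (by fun_prop) (by fun_prop)) fun i => ?_
    rw [h4, h3, h2, ← h1, Submodule.coe_norm]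
  · intro h
    refine (AddMonoidHomClass.isometry_iff_norm L).2 fun f => ?_
    have key : ∀ᵐ t, ‖fiber (L f) t‖ = ‖fiber (f : Sobolev n s) t‖ := by
      filter_upwards [h, hLR f] with t h1 ⟨h2, h3⟩
      rw [h3, (AddMonoidHomClass.isometry_iff_norm _).1 h1]
      rfl
    have h1 : ‖L f‖ ≤ 1 * ‖(f : Sobolev n s)‖ :=
      norm_le_of_fiber_le (key.mono fun t ht => by rw [one_mul, ht])
    have h2 : ‖(f : Sobolev n s)‖ ≤ 1 * ‖L f‖ :=
      norm_le_of_fiber_le (key.mono fun t ht => by rw [one_mul, ht])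
    rw [one_mul] at h1 h2
    exact le_antisymm h1 h2

/-! ### The operator of a bounded range operator -/

theorem aestronglyMeasurable_clm_apply {X H : Type*} [MeasurableSpace X] {μ : Measure X}
    [NormedAddCommGroup H] [NormedSpace ℂ H] {A : X → H →L[ℂ] H}
    (hA : ∀ a, AEStronglyMeasurable (fun x => A x a) μ) {F : X → H}
    (hF : AEStronglyMeasurable F μ) : AEStronglyMeasurable (fun x => A x (F x)) μ := by
  obtain ⟨G, hG, hFG⟩ := hF
  have hs (g : SimpleFunc X H) : AEStronglyMeasurable (fun x => A x (g x)) μ := by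
    -- For a simple function the composition is a finite sum over its values; the general case is a
    -- pointwise limit.
    have : (fun x => A x (g x)) =
        fun x => ∑ y ∈ g.range, (g ⁻¹' {y}).indicator (fun x => A x y) x := by
      ext x
      rw [Finset.sum_eq_single_of_mem (g x) (g.mem_range_self x)]
      · simp
      · intro y _ hy
        exact Set.indicator_of_notMem (fun h => hy h.symm) _
    rw [this]
    exact Finset.aestronglyMeasurable_fun_sum _ fun y _ =>
      (hA y).indicator (g.measurableSet_fiber y)
  have hGm : AEStronglyMeasurable (fun x => A x (G x)) μ :=
    aestronglyMeasurable_of_tendsto_ae Filter.atTop (fun m => hs (hG.approx m))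
      (Filter.Eventually.of_forall fun x =>
        ((A x).continuous.tendsto _).comp (hG.tendsto_approx x))
  refine hGm.congr ?_
  filter_upwards [hFG] with x hx
  rw [hx]

theorem exists_corresponds {R : cube n → PartialOp n s} (hJ : IsRangeFunctionOf J V)
    (hR : IsRangeOperatorOn J R) (hRm : IsMeasurableRangeOperator R)
    (hRb : essSup (fun t : cube n => ‖(R t).op‖ₑ) volume < ∞) :
    ∃ L : V →L[ℂ] Sobolev n s, Corresponds L R := by
  -- Composing with the projection puts all operators on the fixed space `ℓ²_s`, where weak
  -- measurability is assumed.
  let A (t : cube n) : SeqSpace n s →L[ℂ] SeqSpace n s :=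
    (R t).op ∘L (R t).dom.toSubmodule.orthogonalProjectionOnto
  set C := (essSup (fun t : cube n => ‖(R t).op‖ₑ) volume).toReal
  have hAC : ∀ᵐ t, ∀ x, ‖A t x‖ ≤ C * ‖x‖ := by
    filter_upwards [ENNReal.ae_le_essSup fun t : cube n => ‖(R t).op‖ₑ] with t ht x
    have h1 : ‖(R t).op‖ ≤ C := by
      simpa using ENNReal.toReal_mono hRb.ne ht
    calc ‖A t x‖ ≤ ‖(R t).op‖ * ‖(R t).dom.toSubmodule.orthogonalProjectionOnto x‖ :=
          (R t).op.le_opNorm _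
      _ ≤ C * ‖x‖ := by
          gcongr
          exact Submodule.norm_orthogonalProjectionOnto_apply_le _ x
  have hAm (a) : AEStronglyMeasurable (fun t => A t a) volume :=
    aestronglyMeasurable_of_inner fun b => hRm a b
  have hex (f : V) : ∃ g : Sobolev n s, ∀ᵐ t, fiber g t = A t (fiber (f : Sobolev n s) t) :=
    exists_fiber_ae_eq ((memLp_fiber (f : Sobolev n s)).of_le_mul
      (aestronglyMeasurable_clm_apply hAm (aestronglyMeasurable_fiber _))
      (hAC.mono fun t ht => ht _))
  choose T hT using hex
  let L : V →L[ℂ] Sobolev n s := LinearMap.mkContinuous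
    { toFun := T
      -- The chosen `T f` is determined by its fibers, so linearity can be checked fiber by fiber.
      map_add' := fun f g => by
        apply eq_of_fiber_ae_eq
        filter_upwards [hT f, hT g, hT (f + g), fiber_add (T f) (T g),
          fiber_add (f : Sobolev n s) g] with t h1 h2 h3 h4 h5
        rw [h4, h3, h1, h2, Submodule.coe_add, h5, map_add]
      map_smul' := fun z f => by
        apply eq_of_fiber_ae_eq
        filter_upwards [hT f, hT (z • f), fiber_smul z (T f), fiber_smul z (f : Sobolev n s)]
          with t h1 h2 h3 h4
        rw [RingHom.id_apply, h3, h2, h1, Submodule.coe_smul, h4, map_smul] } C fun f => by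
      refine norm_le_of_fiber_le ?_
      filter_upwards [hT f, hAC] with t h1 h2
      exact (congrArg norm h1).trans_le (h2 _)
  refine ⟨L, fun f => ?_⟩
  filter_upwards [hR, hT f, (hJ.mem_iff f).1 f.2] with t h1 h2 h3
  rw [← h1] at h3
  refine ⟨h3, h2.trans ?_⟩
  exact congrArg (R t).op (Submodule.orthogonalProjectionOnto_mem_subspace_eq_self
    (⟨_, h3⟩ : (R t).dom.toSubmodule))

theorem Corresponds.isShiftPreserving {L : V →L[ℂ] Sobolev n s} {R : cube n → PartialOp n s}
    (hLR : Corresponds L R) (hV : IsShiftInvariant V) : IsShiftPreserving hV L := by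
  intro k f
  apply eq_of_fiber_ae_eq
  filter_upwards [hLR f, hLR ⟨(f : Sobolev n s).shift k, hV f f.2 k⟩, fiber_shift k (L f),
    fiber_shift k (f : Sobolev n s)] with t ⟨h1, h2⟩ ⟨h3, h4⟩ h5 h6
  rw [h4, h5, h2, ← map_smul]
  congr 1
  exact Subtype.ext h6

theorem Corresponds.unique {L L' : V →L[ℂ] Sobolev n s} {R : cube n → PartialOp n s}
    (hL : Corresponds L R) (hL' : Corresponds L' R) : L = L' := by
  ext1 f
  apply eq_of_fiber_ae_eq
  filter_upwards [hL f, hL' f] with t ⟨_, h1⟩ ⟨_, h2⟩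
  rw [h1, h2]

end ShiftInv

end

open ShiftInv in
theorem mainTheorem1 {n : ℕ} (hn : 0 < n) (s : ℝ) (V : Submodule ℂ (Sobolev n s))
    (hVc : IsClosed (V : Set (Sobolev n s))) (hV : IsShiftInvariant V) :
    (∃ J : RangeFunction n s, IsRangeFunctionOf J V) ∧
    ∀ J : RangeFunction n s, IsRangeFunctionOf J V →
      -- every shift-preserving operator has a range operator, unique up to null sets
      (∀ L : V →L[ℂ] Sobolev n s, IsShiftPreserving hV L →
        ∃ R : cube n → PartialOp n s,
          (IsRangeOperatorOn J R ∧ IsMeasurableRangeOperator R ∧ Corresponds L R) ∧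
          ∀ R' : cube n → PartialOp n s,
            IsRangeOperatorOn J R' ∧ IsMeasurableRangeOperator R' ∧ Corresponds L R' →
              ∀ᵐ t : cube n, R' t = R t) ∧
      -- every essentially bounded measurable range operator comes from exactly one such operator
      (∀ R : cube n → PartialOp n s, IsRangeOperatorOn J R → IsMeasurableRangeOperator R →
        essSup (fun t : cube n => ‖(R t).op‖ₑ) volume < ∞ →
        ∃! L : V →L[ℂ] Sobolev n s, IsShiftPreserving hV L ∧ Corresponds L R) ∧
      (∀ (L : V →L[ℂ] Sobolev n s) (R : cube n → PartialOp n s), IsShiftPreserving hV L →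
        IsRangeOperatorOn J R → IsMeasurableRangeOperator R → Corresponds L R →
        (Isometry L ↔ ∀ᵐ t : cube n, Isometry (R t).op)) := by
  refine ⟨exists_isRangeFunctionOf hVc hV, fun J hJ => ⟨fun L hL => ?_, fun R hR hRm hRb => ?_,
    fun L R _ hR _ hLR => hLR.isometry_iff hJ hR⟩⟩
  · obtain ⟨R, hR, hRm, hLR⟩ := hL.exists_rangeOperator hVc hJ
    exact ⟨R, ⟨hR, hRm, hLR⟩, fun R' ⟨hR', _, hLR'⟩ => hLR.ae_eq hJ hR hR' hLR'⟩
  · obtain ⟨L, hL⟩ := exists_corresponds hJ hR hRm hRb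
    exact ⟨L, ⟨hL.isShiftPreserving hV, hL⟩, fun L' ⟨_, hL'⟩ => hL'.unique hL⟩
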